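/- Let $\mathcal H$ be a finite-dimensional complex Hilbert space, $T>0$, $\omega=2\pi/T$, $M\in\mathbb N$, and let $H(t)=\sum_{|m|\le M}H_m e^{-im\omega t}$ be Hermitian for all $t\in\mathbb R$, with operator norms $\|H_m\|\le\alpha$ for $|m|\le M$. A real number $\epsilon$ is a quasienergy if $e^{-i\epsilon t}\phi(t)$ solves $i\,\partial_t\psi(t)=H(t)\psi(t)$ for some $T$-periodic $\phi:\mathbb R\to\mathcal H$ that is not identically zero. For $L\in\mathbb N$ let $[L]=\{-L+1,\dots,L\}$ and let $$H_F^L=\sum_{|m|\le M}\ \sum_{l\in[L],\,l+m\in[L]}|l+m\rangle\langle l|\otimes H_m-\sum_{l\in[L]}l\omega\,|l\rangle\langle l|\otimes I$$ be the truncated Floquet Hamiltonian on $\mathbb C^{[L]}\otimes\mathcal H$. Put $\mathrm{BZ}=[-\omega/2,\omega/2)$, and let $x \bmod 1$ denote the representative in $[-1/2,1/2)$. (1) For every $L\ge 1$, every quasienergy $\epsilon_n\in\mathrm{BZ}$ and every $l\in[L]$, $H_F^L$ has an eigenvalue $\tilde\epsilon$ with $$\frac{|\tilde\epsilon-(\epsilon_n-l\omega)|}{\omega}\le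 8(2M+1)^2\alpha T\exp\Big(-\frac{L-|l|}{2M+1}+\frac{\sinh 1}{2\pi}\alpha T\Big);$$ in particular ($l=0$), some eigenvalue satisfies $|\tilde\epsilon-\epsilon_n|/\omega\le 8(2M+1)^2\alpha T\exp\big(-\frac{L}{2M+1}+\frac{\sinh 1}{2\pi}\alpha T\big)$. (2) For every $L$ and every eigenvalue $\tilde\epsilon$ of $H_F^L$ there is a quasienergy $\epsilon_n\in\mathrm{BZ}$ with $$\Big|\Big(\frac{\epsilon_n-\tilde\epsilon}{\omega}\Big)\bmod 1\Big|\le 9(2M+1)^2\alpha T\exp\Big(-\frac{L-|\tilde\epsilon|/\omega}{2M+1}+\frac{\sinh 1}{2\pi}\alpha T\Big).$$ (3) Consequently a cutoff $L\in\Theta(\alpha T+\log(1/\varepsilon))$ suffices for accuracy $\varepsilon$: there is a constant $C>0$ depending only on $M$ such that, for all $\mathcal H$, $T$, $\alpha$, $(H_m)$ as above, all $0<\varepsilon\le1$ and all integers $L\ge1$ with $L\ge C(\alpha T+\log(1/\varepsilon))$, every quasienergy $\epsilon_n\in\mathrm{BZ}$ satisfies $|\tilde\epsilon-\epsilon_n|/\omega\le\varepsilon$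 for some eigenvalue $\tilde\epsilon$ of $H_F^L$, and for every eigenvalue $\tilde\epsilon\in[-\omega,\omega)$ of $H_F^L$ there is a quasienergy $\epsilon_n\in\mathrm{BZ}$ with $|((\epsilon_n-\tilde\epsilon)/\omega)\bmod 1|\le\varepsilon$. -/

import Mathlib

namespace Floquet

noncomputable section

/-- The frequency `ω = 2π / T` belonging to the period `T`. -/
def freq (T : ℝ) : ℝ := 2 * Real.pi / T

/-- The zeroth Brillouin zone `[-ω/2, ω/2)`. -/
def brillouinZone (T : ℝ) : Set ℝ := Set.Ico (-(freq T / 2)) (freq T / 2)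

/-- The representative of `x` modulo `1` in `[-1/2, 1/2)`. -/
def modOne (x : ℝ) : ℝ := toIcoMod (zero_lt_one : (0 : ℝ) < 1) (-(1 / 2)) x

/-- The Fourier indices `[L] = {-L+1, …, L}` that are kept by the truncation. -/
def indices (L : ℕ) : Finset ℤ := Finset.Icc (-(L : ℤ) + 1) L

section

variable {E : Type*} [NormedAddCommGroup E] [InnerProductSpace ℂ E]

/-- The time-periodic Hamiltonian `H(t) = ∑_{|m| ≤ M} H_m e^{-imωt}`. -/
def hamiltonian (M : ℕ) (T : ℝ) (H : ℤ → E →L[ℂ] E) (t : ℝ) : E →L[ℂ] E :=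
  ∑ m ∈ Finset.Icc (-(M : ℤ)) M,
    Complex.exp (-Complex.I * (m : ℂ) * (freq T : ℂ) * (t : ℂ)) • H m

/-- `ε` is a quasienergy of `H(t)`: for some `T`-periodic `φ`, not identically zero, the function
`ψ(t) = e^{-iεt} φ(t)` solves the Schrödinger equation `i ψ'(t) = H(t) ψ(t)`. -/
def IsQuasienergy (M : ℕ) (T : ℝ) (H : ℤ → E →L[ℂ] E) (ε : ℝ) : Prop :=
  ∃ φ : ℝ → E, φ ≠ 0 ∧ Function.Periodic φ T ∧
    ∀ t : ℝ, HasDerivAt (fun s : ℝ => Complex.exp (-Complex.I * (ε : ℂ) * (s : ℂ)) • φ s)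
      (-Complex.I • hamiltonian M T H t (Complex.exp (-Complex.I * (ε : ℂ) * (t : ℂ)) • φ t)) t

/-- The truncated Sambe space: families of vectors of `E` indexed by `[L]`,
with the Hilbert space norm. -/
abbrev TruncSambe (E : Type*) [NormedAddCommGroup E] (L : ℕ) : Type _ :=
  PiLp 2 (fun _ : indices L => E)

/-- The truncated Floquet Hamiltonian
`H_F^L = ∑_{|m| ≤ M} ∑_{l ∈ [L], l + m ∈ [L]} |l+m⟩⟨l| ⊗ H_m - ∑_{l ∈ [L]} l ω |l⟩⟨l| ⊗ I`;
its `j`-th component collects the terms with `l + m = j`. -/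
def truncHamiltonian (M : ℕ) (T : ℝ) (H : ℤ → E →L[ℂ] E) (L : ℕ) :
    TruncSambe E L →ₗ[ℂ] TruncSambe E L where
  toFun ψ := WithLp.toLp 2 fun j : indices L =>
    (∑ l : indices L, if |(j : ℤ) - (l : ℤ)| ≤ (M : ℤ) then H ((j : ℤ) - (l : ℤ)) (ψ l) else 0)
      - (((j : ℤ) : ℂ) * (freq T : ℂ)) • ψ j
  map_add' ψ χ := by
    ext j
    have key : ∀ l : indices L,
        (if |(j : ℤ) - (l : ℤ)| ≤ (M : ℤ) then H ((j : ℤ) - (l : ℤ)) (ψ l + χ l) else 0)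
          = (if |(j : ℤ) - (l : ℤ)| ≤ (M : ℤ) then H ((j : ℤ) - (l : ℤ)) (ψ l) else 0)
            + (if |(j : ℤ) - (l : ℤ)| ≤ (M : ℤ) then H ((j : ℤ) - (l : ℤ)) (χ l) else 0) := by
      intro l
      split_ifs <;> simp
    simp only [PiLp.add_apply, key, Finset.sum_add_distrib, smul_add]
    abel
  map_smul' c ψ := by
    ext j
    simp only [PiLp.smul_apply, map_smul, RingHom.id_apply, smul_sub, Finset.smul_sum]
    rw [smul_comm c]
    congr 1
    refine Finset.sum_congr rfl fun l _ => ?_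
    split_ifs <;> simp

/-- `x` is an eigenvalue of the truncated Floquet Hamiltonian `H_F^L`. -/
def IsTruncEigenvalue (M : ℕ) (T : ℝ) (H : ℤ → E →L[ℂ] E) (L : ℕ) (x : ℝ) : Prop :=
  Module.End.HasEigenvalue (truncHamiltonian M T H L) (x : ℂ)

end

end

end Floquet

/-!
In Fourier space a Floquet mode of quasienergy `ε` is an `ℓ²` family `a : ℤ → E` with
`∑ m, H_m a_{k-m} = (kω + ε) a_k`, and an eigenvector of `H_F^L` solves the same equation on `[L]`
and vanishes elsewhere. Both localize exponentially around `k = -ε/ω`, so cutting off the first, or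
extending the second by zero, violates the equation only by exponentially small boundary terms. An
approximate eigenvector of a normal operator certifies an eigenvalue nearby
(`exists_hasEigenvalue_near`), and both directions follow.

Localization (`sum_compl_le`, `le_exp_of_le_abs`) is a statement about `b_k = ‖a_k‖` alone, which
satisfies `ω |k + θ| b_k² ≤ α b_k ∑_{|m| ≤ M} b_{k-m}`. Put
`f(s) = ∑ e^{2 s min(|k + θ|, N)} b_k²`. The weight changes by at most `e^{s|m|}` under a shift by
`m`, which gives `f' ≤ (2α/ω) (∑_{|m| ≤ M} e^{s|m|}) f`. Integration up to `s = 1/(2M+1)` produces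
the factor `exp (2 sinh 1 · α/ω)`, and `α/ω = αT/2π`.

From quasienergies to eigenvalues: the Fourier coefficients of a mode, shifted by `l` and restricted
to `[L]`, form an approximate eigenvector of the Hermitian matrix `H_F^L`
(`exists_truncEigenvalue_near_of_small`). If the exponential in the bound is not small, it is enough
that eigenvalues lie within `(2M+1)α` of the diagonal and that `|ε| ≤ (2M+1)α`.

From eigenvalues to quasienergies: an eigenvector of `H_F^L` with eigenvalue `x` yields a periodic
trigonometric polynomial `v` with `H v - i v' - x v` small (`norm_residual_le`). Transported back by
the unitary propagator over one period, which starts where `‖v‖` is at least its root mean square,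
it becomes an approximate eigenvector of the monodromy operator `U(T)` at `e^{-ixT}`
(`exists_quasienergy_near_of_residual`). The eigenvalues of `U(T)` are the numbers `e^{-iεT}` with
`ε` a quasienergy, and `|e^{-iεT} - e^{-ixT}| ≥ 4 |(ε - x)/ω mod 1|`.
-/

namespace Floquet

/-! ### Exponential decay by weighted sums -/

theorem sum_Icc_abs (M : ℕ) :
    ∑ m ∈ Finset.Icc (-(M : ℤ)) M, |(m : ℝ)| = M * (M + 1) ∧
    ∑ m ∈ Finset.Icc (-(M : ℤ)) M, |(m : ℝ)| ^ 2 = M * (M + 1) * (2 * M + 1) / 3 := by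
  induction M with
  | zero => simp
  | succ M ih =>
    have hins : Finset.Icc (-((M + 1 : ℕ) : ℤ)) ((M + 1 : ℕ) : ℤ)
        = insert ((M : ℤ) + 1) (insert (-((M : ℤ) + 1)) (Finset.Icc (-(M : ℤ)) M)) := by
      ext m
      simp only [Finset.mem_Icc, Finset.mem_insert]
      omega
    have h1 : -((M : ℤ) + 1) ∉ Finset.Icc (-(M : ℤ)) M := by simp
    have h2 : ((M : ℤ) + 1) ∉ insert (-((M : ℤ) + 1)) (Finset.Icc (-(M : ℤ)) M) := by
      simp only [Finset.mem_Icc, Finset.mem_insert]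
      omega
    rw [hins, Finset.sum_insert h2, Finset.sum_insert h1, Finset.sum_insert h2,
      Finset.sum_insert h1, ih.1, ih.2]
    have h3 : (0 : ℝ) ≤ (M : ℝ) + 1 := by positivity
    push_cast
    rw [abs_neg, abs_of_nonneg h3]
    constructor <;> ring

/-- In units of `α`, a bound on the Hamiltonian conjugated by an exponential weight. It is kept to
second order in `s`, because its maximum `4 (2M + 1) / 3` over `0 ≤ s ≤ 1 / (2M + 1)` is too large
for the constant `sinh 1` obtained by integration. -/
theorem sum_exp_abs_le (M : ℕ) {s : ℝ} (hs : 0 ≤ s) (hs1 : s ≤ 1 / (2 * M + 1)) :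
    ∑ m ∈ Finset.Icc (-(M : ℤ)) M, Real.exp (s * |(m : ℝ)|) ≤
      (2 * M + 1) + (2 * M + 1) ^ 2 / 4 * s + (2 * M + 1) ^ 3 / 12 * s ^ 2 := by
  have hM : (0 : ℝ) ≤ M := Nat.cast_nonneg M
  have hsM : s * (2 * M + 1) ≤ 1 := by
    rwa [le_div_iff₀ (by positivity)] at hs1
  have key : ∀ m ∈ Finset.Icc (-(M : ℤ)) M,
      Real.exp (s * |(m : ℝ)|) ≤ 1 + s * |(m : ℝ)| + s ^ 2 * |(m : ℝ)| ^ 2 := by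
    intro m hm
    have hm' : |(m : ℝ)| ≤ M := by
      rw [Finset.mem_Icc] at hm
      rw [abs_le]
      exact_mod_cast hm
    have h0 : 0 ≤ s * |(m : ℝ)| := by positivity
    have h1 : s * |(m : ℝ)| ≤ 1 := by nlinarith
    have := Real.abs_exp_sub_one_sub_id_le (x := s * |(m : ℝ)|) (by rwa [abs_of_nonneg h0])
    have := (abs_le.1 this).2
    nlinarith
  refine (Finset.sum_le_sum key).trans ?_
  rw [Finset.sum_add_distrib, Finset.sum_add_distrib, ← Finset.mul_sum, ← Finset.mul_sum,
    (sum_Icc_abs M).1, (sum_Icc_abs M).2]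
  have hc : ∑ m ∈ Finset.Icc (-(M : ℤ)) M, (1 : ℝ) = 2 * M + 1 := by
    rw [Finset.sum_const, Int.card_Icc, nsmul_eq_mul, mul_one]
    have : ((M : ℤ) + 1 - -(M : ℤ)).toNat = 2 * M + 1 := by omega
    rw [this]; push_cast; ring
  rw [hc]
  have h4 : (M : ℝ) * (M + 1) ≤ (2 * M + 1) ^ 2 / 4 := by nlinarith
  have h5 : (M : ℝ) * (M + 1) * (2 * M + 1) / 3 ≤ (2 * M + 1) ^ 3 / 12 := by
    have := mul_le_mul_of_nonneg_right h4 (by positivity : (0 : ℝ) ≤ 2 * M + 1)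
    nlinarith
  have h6 := mul_le_mul_of_nonneg_left h4 hs
  have h7 := mul_le_mul_of_nonneg_left h5 (sq_nonneg s)
  linarith

/-- The left side is the integral over `[0, 1]` of `1 + u / 4 + u² / 12`, the polynomial of
`sum_exp_abs_le` in the variable `u = (2M + 1) s`. -/
theorem sinh_one_lower : (1 : ℝ) + 1 / 8 + 1 / 36 ≤ Real.sinh 1 := by
  rw [Real.sinh_eq]
  have h1 := Real.exp_one_gt_d9
  have h2 : Real.exp (-1) ≤ 1 / 2.7182818283 := by
    rw [Real.exp_neg, ← one_div]
    exact one_div_le_one_div_of_le (by norm_num) h1.le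
  norm_num at h1 h2 ⊢
  linarith

section weight

variable {M : ℕ} {α ω θ N : ℝ} {b : ℤ → ℝ}

/-- The squared `ℓ²` norm of `b` with the exponential weight `e^{s min(|k + θ|, N)}`. Clamping at
`N` keeps the weight bounded, so that the sum is finite for every `b ∈ ℓ²`. -/
noncomputable def weightedSum (θ N : ℝ) (b : ℤ → ℝ) (s : ℝ) : ℝ :=
  ∑' k : ℤ, Real.exp (2 * s * min |(k : ℝ) + θ| N) * b k ^ 2

theorem clamp_nonneg (hN : 0 ≤ N) (k : ℤ) : 0 ≤ min |(k : ℝ) + θ| N :=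
  le_min (abs_nonneg _) hN

/-- The clamped distance is Lipschitz under shifts. -/
theorem clamp_sub_le (k m : ℤ) :
    min |(k : ℝ) + θ| N ≤ |(m : ℝ)| + min |((k - m : ℤ) : ℝ) + θ| N := by
  have h : |(k : ℝ) + θ| ≤ |(m : ℝ)| + |((k - m : ℤ) : ℝ) + θ| := by
    refine le_trans (le_of_eq ?_) (abs_add_le _ _)
    push_cast
    ring_nf
  have h0 := abs_nonneg (m : ℝ)
  rcases min_cases |((k - m : ℤ) : ℝ) + θ| N with h1 | h1
  · rw [h1.1]; exact (min_le_left _ _).trans h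
  · rw [h1.1]; exact (min_le_right _ _).trans (by linarith)

theorem summable_weight (hN : 0 ≤ N) (hs : Summable fun k => b k ^ 2) (s : ℝ) :
    Summable fun k : ℤ => Real.exp (2 * s * min |(k : ℝ) + θ| N) * b k ^ 2 := by
  refine Summable.of_nonneg_of_le (fun k => by positivity) (fun k => ?_)
    (hs.mul_left (Real.exp (2 * |s| * N)))
  refine mul_le_mul_of_nonneg_right (Real.exp_le_exp.2 ?_) (sq_nonneg _)
  have h1 : s * min |(k : ℝ) + θ| N ≤ |s| * min |(k : ℝ) + θ| N :=
    mul_le_mul_of_nonneg_right (le_abs_self s) (clamp_nonneg hN k)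
  have h2 : |s| * min |(k : ℝ) + θ| N ≤ |s| * N :=
    mul_le_mul_of_nonneg_left (min_le_right _ _) (abs_nonneg s)
  linarith

theorem hasDerivAt_weightedSum (hN : 0 ≤ N) (hs : Summable fun k => b k ^ 2) (s : ℝ) :
    HasDerivAt (weightedSum θ N b)
      (∑' k : ℤ, 2 * min |(k : ℝ) + θ| N * (Real.exp (2 * s * min |(k : ℝ) + θ| N) * b k ^ 2))
      s := by
  have hmem : s ∈ Metric.ball (0 : ℝ) (|s| + 1) := by simp
  refine hasDerivAt_tsum_of_isPreconnected
    (g := fun (k : ℤ) (s : ℝ) => Real.exp (2 * s * min |(k : ℝ) + θ| N) * b k ^ 2)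
    (g' := fun (k : ℤ) (s : ℝ) =>
      2 * min |(k : ℝ) + θ| N * (Real.exp (2 * s * min |(k : ℝ) + θ| N) * b k ^ 2))
    (hs.mul_left (2 * N * Real.exp (2 * (|s| + 1) * N))) Metric.isOpen_ball
    (convex_ball (0 : ℝ) (|s| + 1)).isPreconnected (fun k y _ => ?_) (fun k y hy => ?_)
    hmem (summable_weight hN hs s) hmem
  · have h := (((hasDerivAt_id y).const_mul 2).mul_const (min |(k : ℝ) + θ| N)).exp.mul_const
      (b k ^ 2)
    refine h.congr_deriv ?_
    simp only [id]
    ring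
  · have hc := clamp_nonneg (θ := θ) hN k
    have hc' := min_le_right |(k : ℝ) + θ| N
    rw [Real.norm_of_nonneg (by positivity), ← mul_assoc]
    have hy' : y ≤ |s| + 1 := by
      rw [mem_ball_zero_iff, Real.norm_eq_abs] at hy
      exact (le_abs_self y).trans hy.le
    gcongr

/-- The differential inequality behind the exponential decay. The weight is `|m|`-Lipschitz under
the shift by `m`, so passing it through `b k * b (k - m)` costs `e^{s|m|}`. -/
theorem deriv_weightedSum_le (hω : 0 < ω) (hα : 0 ≤ α) (hN : 0 ≤ N) (hb : ∀ k, 0 ≤ b k)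
    (hs : Summable fun k => b k ^ 2)
    (h : ∀ k : ℤ, ω * |(k : ℝ) + θ| * b k ^ 2 ≤
      α * (b k * ∑ m ∈ Finset.Icc (-(M : ℤ)) M, b (k - m))) {s : ℝ} (hs0 : 0 ≤ s) :
    (∑' k : ℤ, 2 * min |(k : ℝ) + θ| N * (Real.exp (2 * s * min |(k : ℝ) + θ| N) * b k ^ 2)) ≤
      2 * α / ω * (∑ m ∈ Finset.Icc (-(M : ℤ)) M, Real.exp (s * |(m : ℝ)|))
        * weightedSum θ N b s := by
  set c : ℤ → ℝ := fun k => min |(k : ℝ) + θ| N with hc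
  set d : ℤ → ℝ := fun k => Real.exp (2 * s * c k) * b k ^ 2 with hd
  have hds : HasSum d (weightedSum θ N b s) := (summable_weight hN hs s).hasSum
  have hshift : ∀ m : ℤ, HasSum (fun k => d (k - m)) (weightedSum θ N b s) := fun m =>
    (Equiv.subRight m).hasSum_iff.2 hds
  have hR : HasSum (fun k => ∑ m ∈ Finset.Icc (-(M : ℤ)) M,
      α / ω * Real.exp (s * |(m : ℝ)|) * (d k + d (k - m)))
      (∑ m ∈ Finset.Icc (-(M : ℤ)) M, α / ω * Real.exp (s * |(m : ℝ)|) *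
        (weightedSum θ N b s + weightedSum θ N b s)) :=
    hasSum_sum fun m _ => (hds.add (hshift m)).mul_left _
  have hval : (∑ m ∈ Finset.Icc (-(M : ℤ)) M, α / ω * Real.exp (s * |(m : ℝ)|) *
        (weightedSum θ N b s + weightedSum θ N b s)) =
      2 * α / ω * (∑ m ∈ Finset.Icc (-(M : ℤ)) M, Real.exp (s * |(m : ℝ)|))
        * weightedSum θ N b s := by
    rw [← Finset.sum_mul, ← Finset.mul_sum]
    ring
  rw [← hval, ← hR.tsum_eq]
  have hpt : ∀ k, 2 * c k * d k ≤ ∑ m ∈ Finset.Icc (-(M : ℤ)) M,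
      α / ω * Real.exp (s * |(m : ℝ)|) * (d k + d (k - m)) := by
    intro k
    have h1 : c k * b k ^ 2 ≤ α / ω * (b k * ∑ m ∈ Finset.Icc (-(M : ℤ)) M, b (k - m)) := by
      rw [div_mul_eq_mul_div, le_div_iff₀ hω]
      refine le_trans ?_ (h k)
      have : c k ≤ |(k : ℝ) + θ| := min_le_left _ _
      have := mul_le_mul_of_nonneg_right this (mul_nonneg (sq_nonneg (b k)) hω.le)
      linarith
    have h2 : 2 * c k * d k = 2 * Real.exp (2 * s * c k) * (c k * b k ^ 2) := by
      simp only [hd]; ring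
    rw [h2]
    refine (mul_le_mul_of_nonneg_left h1 (by positivity)).trans ?_
    rw [Finset.mul_sum, Finset.mul_sum, Finset.mul_sum]
    refine Finset.sum_le_sum fun m _ => ?_
    have h3 : 2 * (Real.exp (2 * s * c k) * (b k * b (k - m))) ≤
        Real.exp (s * |(m : ℝ)|) * (d k + d (k - m)) := by
      have hsq : ∀ j, d j = (Real.exp (s * c j) * b j) ^ 2 := by
        intro j
        simp only [hd]
        rw [mul_pow, ← Real.exp_nat_mul]
        congr 2
        push_cast; ring
      have h4 : Real.exp (2 * s * c k) ≤
          Real.exp (s * |(m : ℝ)|) * (Real.exp (s * c k) * Real.exp (s * c (k - m))) := by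
        rw [← Real.exp_add, ← Real.exp_add]
        refine Real.exp_le_exp.2 ?_
        have := mul_le_mul_of_nonneg_left (clamp_sub_le (θ := θ) (N := N) k m) hs0
        simp only [hc]
        linarith
      have h5 := mul_le_mul_of_nonneg_right h4 (mul_nonneg (hb k) (hb (k - m)))
      have h6 := two_mul_le_add_sq (Real.exp (s * c k) * b k) (Real.exp (s * c (k - m)) * b (k - m))
      rw [← hsq, ← hsq] at h6
      have h7 := mul_le_mul_of_nonneg_left h6 (Real.exp_pos (s * |(m : ℝ)|)).le
      nlinarith
    have h8 := mul_le_mul_of_nonneg_left h3 (div_nonneg hα hω.le)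
    linarith
  refine Summable.tsum_le_tsum hpt ?_ hR.summable
  refine Summable.of_nonneg_of_le (fun k => ?_) hpt hR.summable
  have := clamp_nonneg (θ := θ) hN k
  positivity

/-- Integrating the differential inequality over `0 ≤ s ≤ 1 / (2M + 1)`. -/
theorem weightedSum_le (hω : 0 < ω) (hα : 0 ≤ α) (hN : 0 ≤ N) (hb : ∀ k, 0 ≤ b k)
    (hs : Summable fun k => b k ^ 2)
    (h : ∀ k : ℤ, ω * |(k : ℝ) + θ| * b k ^ 2 ≤
      α * (b k * ∑ m ∈ Finset.Icc (-(M : ℤ)) M, b (k - m))) :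
    weightedSum θ N b (1 / (2 * M + 1)) ≤
      Real.exp (2 * (Real.sinh 1 * (α / ω))) * ∑' k, b k ^ 2 := by
  set n : ℝ := 2 * M + 1 with hn
  have hnpos : 0 < n := by positivity
  set f := weightedSum θ N b with hf
  have hfnn : ∀ s, 0 ≤ f s := fun s => tsum_nonneg fun k => by positivity
  set G : ℝ → ℝ := fun s => 2 * α / ω * (n * s + n ^ 2 / 8 * s ^ 2 + n ^ 3 / 36 * s ^ 3) with hG
  have hGd : ∀ s, HasDerivAt G (2 * α / ω * (n + n ^ 2 / 4 * s + n ^ 3 / 12 * s ^ 2)) s := by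
    intro s
    have := ((((hasDerivAt_id s).const_mul n).add (((hasDerivAt_id s).pow 2).const_mul
      (n ^ 2 / 8))).add (((hasDerivAt_id s).pow 3).const_mul (n ^ 3 / 36))).const_mul (2 * α / ω)
    refine this.congr_deriv ?_
    push_cast
    simp only [id, mul_one, pow_one]
    ring
  have hfd := fun s => hasDerivAt_weightedSum (θ := θ) hN hs s
  have hFd := fun s => (hfd s).mul (hGd s).neg.exp
  have hanti : AntitoneOn (fun s => f s * Real.exp (-G s)) (Set.Icc 0 (1 / n)) := by
    refine antitoneOn_of_deriv_nonpos (convex_Icc _ _)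
      (fun s _ => (hFd s).continuousAt.continuousWithinAt)
      (fun s _ => (hFd s).differentiableAt.differentiableWithinAt) (fun s hmem => ?_)
    rw [interior_Icc] at hmem
    have h0 : 0 ≤ s := hmem.1.le
    have hd := (hFd s).deriv
    have hle := deriv_weightedSum_le hω hα hN hb hs h h0
    have hle2 := sum_exp_abs_le M h0 hmem.2.le
    rw [← hn] at hle2
    have hle3 : 2 * α / ω * (∑ m ∈ Finset.Icc (-(M : ℤ)) M, Real.exp (s * |(m : ℝ)|)) * f s ≤
        2 * α / ω * (n + n ^ 2 / 4 * s + n ^ 3 / 12 * s ^ 2) * f s :=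
      mul_le_mul_of_nonneg_right (mul_le_mul_of_nonneg_left hle2 (by positivity)) (hfnn s)
    refine le_trans (le_of_eq hd) ?_
    have := mul_le_mul_of_nonneg_right (hle.trans hle3) (Real.exp_pos (-G s)).le
    simp only [Pi.neg_apply]
    linarith
  have hmono := hanti (Set.left_mem_Icc.2 (by positivity)) (Set.right_mem_Icc.2 (by positivity))
    (by positivity : (0 : ℝ) ≤ 1 / n)
  have hG0 : G 0 = 0 := by simp [hG]
  have hf0 : f 0 = ∑' k, b k ^ 2 := by simp [hf, weightedSum]
  have hG1 : G (1 / n) ≤ 2 * (Real.sinh 1 * (α / ω)) := by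
    have : G (1 / n) = 2 * (α / ω) * (1 + 1 / 8 + 1 / 36) := by
      simp only [hG]
      field_simp
    rw [this]
    have := mul_le_mul_of_nonneg_left sinh_one_lower (by positivity : 0 ≤ 2 * (α / ω))
    linarith
  simp only [hG0, neg_zero, Real.exp_zero, mul_one, hf0] at hmono
  rw [Real.exp_neg, mul_inv_le_iff₀ (Real.exp_pos _)] at hmono
  refine hmono.trans ?_
  rw [mul_comm]
  exact mul_le_mul_of_nonneg_right (Real.exp_le_exp.2 hG1) (tsum_nonneg fun k => sq_nonneg _)

/-- Exponential decay away from `-θ` of a nonnegative `ℓ²` sequence that satisfies the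
componentwise norm inequality of an eigenvector of the Floquet Hamiltonian: the part of `b` on
`|k + θ| ≥ R` carries at most the fraction `exp (2 (sinh 1 · α / ω - R / (2M + 1)))` of its squared
norm. -/
theorem sum_compl_le (hω : 0 < ω) (hα : 0 ≤ α) (hb : ∀ k, 0 ≤ b k)
    (hs : Summable fun k => b k ^ 2)
    (h : ∀ k : ℤ, ω * |(k : ℝ) + θ| * b k ^ 2 ≤
      α * (b k * ∑ m ∈ Finset.Icc (-(M : ℤ)) M, b (k - m))) (R : ℝ) (S : Set ℤ)
    (hS : ∀ k ∈ S, R ≤ |(k : ℝ) + θ|) :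
    ∑' k : S, b k ^ 2 ≤
      Real.exp (2 * (Real.sinh 1 * (α / ω) - R / (2 * M + 1))) * ∑' k, b k ^ 2 := by
  set n : ℝ := 2 * M + 1 with hn
  have hnpos : 0 < n := by positivity
  -- clamping at the radius itself suffices; for `R < 0` the weight is trivial and so is the bound
  have hN : 0 ≤ max R 0 := le_max_right _ _
  have hmain := weightedSum_le hω hα hN hb hs h
  rw [← hn] at hmain
  have hw := summable_weight (θ := θ) hN hs (1 / n)
  have h1 : Real.exp (2 * (R / n)) * ∑' k : S, b k ^ 2 ≤ weightedSum θ (max R 0) b (1 / n) := by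
    rw [← tsum_mul_left]
    refine le_trans (Summable.tsum_le_tsum (fun k => ?_) ((hs.subtype S).mul_left _)
      (hw.subtype S)) (Summable.tsum_subtype_le _ S (fun k => by positivity) hw)
    refine mul_le_mul_of_nonneg_right (Real.exp_le_exp.2 ?_) (sq_nonneg _)
    have h2 : max R 0 ≤ |((k : ℤ) : ℝ) + θ| := max_le (hS k k.2) (abs_nonneg _)
    rw [min_eq_right h2]
    have : R / n ≤ max R 0 / n := div_le_div_of_nonneg_right (le_max_left _ _) hnpos.le
    calc 2 * (R / n) ≤ 2 * (max R 0 / n) := by linarith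
      _ = 2 * (1 / n) * max R 0 := by ring
  have h3 := h1.trans hmain
  rw [mul_sub, Real.exp_sub, div_mul_eq_mul_div, le_div_iff₀ (Real.exp_pos _), mul_comm]
  exact h3

/-- The pointwise form of `sum_compl_le`. -/
theorem le_exp_of_le_abs (hω : 0 < ω) (hα : 0 ≤ α) (hb : ∀ k, 0 ≤ b k)
    (hs : Summable fun k => b k ^ 2)
    (h : ∀ k : ℤ, ω * |(k : ℝ) + θ| * b k ^ 2 ≤
      α * (b k * ∑ m ∈ Finset.Icc (-(M : ℤ)) M, b (k - m))) {R : ℝ} {k : ℤ}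
    (hk : R ≤ |(k : ℝ) + θ|) :
    b k ≤ Real.exp (Real.sinh 1 * (α / ω) - R / (2 * M + 1)) * √(∑' k, b k ^ 2) := by
  have h1 := sum_compl_le hω hα hb hs h R {k} (by simpa using hk)
  rw [tsum_singleton k (fun k => b k ^ 2)] at h1
  refine abs_le_of_sq_le_sq' ?_ (by positivity) |>.2
  rw [mul_pow, Real.sq_sqrt (tsum_nonneg fun k => sq_nonneg _), ← Real.exp_nat_mul]
  exact_mod_cast h1

end weight

/-! ### Approximate eigenvectors of normal operators -/

section normal

variable {V : Type*} [NormedAddCommGroup V] [InnerProductSpace ℂ V] [FiniteDimensional ℂ V]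

/-- For a normal operator, an approximate eigenvector `z` with residual `‖A z - μ z‖ ≤ η ‖z‖` forces
an eigenvalue within `η` of `μ`. The lowest eigenspace of `(A - μ)† (A - μ)` is invariant under `A`,
and `A` has an eigenvector there. -/
theorem exists_hasEigenvalue_near {A : V →ₗ[ℂ] V} (hA : Commute (LinearMap.adjoint A) A)
    {μ : ℂ} {η : ℝ} {z : V} (hz : z ≠ 0) (hη : ‖A z - μ • z‖ ≤ η * ‖z‖) :
    ∃ ν : ℂ, Module.End.HasEigenvalue A ν ∧ ‖ν - μ‖ ≤ η := by
  have hzpos : 0 < ‖z‖ := norm_pos_iff.2 hz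
  have hη0 : 0 ≤ η := by
    by_contra hneg
    have := mul_neg_of_neg_of_pos (not_le.1 hneg) hzpos
    linarith [norm_nonneg (A z - μ • z)]
  have : Nontrivial V := ⟨z, 0, hz⟩
  set B : V →ₗ[ℂ] V := A - μ • 1 with hB
  set D : V →ₗ[ℂ] V := LinearMap.adjoint B * B with hD
  have hDinner : ∀ x y, inner ℂ (D x) y = inner ℂ (B x) (B y) := fun x y => by
    rw [hD, Module.End.mul_apply, LinearMap.adjoint_inner_left]
  have hDsymm : D.IsSymmetric := fun x y => by
    rw [hDinner, hD, Module.End.mul_apply, LinearMap.adjoint_inner_right]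
  have hcomm : Commute D A := by
    have h1 : Commute B A := by
      rw [hB]
      exact (Commute.refl A).sub_left ((Commute.one_left A).smul_left μ)
    have h2 : Commute (LinearMap.adjoint B) A := by
      have : LinearMap.adjoint B = LinearMap.adjoint A - (starRingEnd ℂ μ) • 1 := by
        rw [hB, map_sub, map_smulₛₗ]
        congr 2
        exact star_one (V →ₗ[ℂ] V)
      rw [this]
      exact hA.sub_left ((Commute.one_left A).smul_left _)
    exact h2.mul_left h1
  set d : ℝ := ⨅ x : { x : V // x ≠ 0 }, RCLike.re (inner ℂ (D x) (x : V)) / ‖(x : V)‖ ^ 2 with hd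
  have hDd : Module.End.HasEigenvalue D (d : ℂ) :=
    hDsymm.hasEigenvalue_iInf_of_finiteDimensional
  have hquot : ∀ x : V, RCLike.re (inner ℂ (D x) x) = ‖B x‖ ^ 2 := fun x => by
    rw [hDinner, inner_self_eq_norm_sq (𝕜 := ℂ)]
  have hdle : d ≤ η ^ 2 := by
    have hbdd : BddBelow (Set.range fun x : { x : V // x ≠ 0 } =>
        RCLike.re (inner ℂ (D x) (x : V)) / ‖(x : V)‖ ^ 2) := by
      refine ⟨0, ?_⟩
      rintro _ ⟨x, rfl⟩
      simp only [hquot]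
      positivity
    refine (ciInf_le hbdd ⟨z, hz⟩).trans ?_
    simp only [hquot]
    rw [div_le_iff₀ (by positivity), ← mul_pow]
    refine pow_le_pow_left₀ (norm_nonneg _) ?_ 2
    simpa [hB] using hη
  have hmaps : ∀ x ∈ Module.End.eigenspace D (d : ℂ), A x ∈ Module.End.eigenspace D (d : ℂ) := by
    intro x hx
    rw [Module.End.mem_eigenspace_iff] at hx ⊢
    have : D (A x) = A (D x) := LinearMap.congr_fun hcomm.eq x
    rw [this, hx, map_smul]
  have hnt : Nontrivial (Module.End.eigenspace D (d : ℂ)) :=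
    Submodule.nontrivial_iff_ne_bot.2 hDd
  obtain ⟨ν, hν⟩ := Module.End.exists_eigenvalue (A.restrict hmaps)
  obtain ⟨y, hy⟩ := hν.exists_hasEigenvector
  have hy0 : (y : V) ≠ 0 := fun h => hy.2 (Subtype.ext h)
  have hAy : A y = ν • (y : V) := congrArg Subtype.val hy.apply_eq_smul
  refine ⟨ν, Module.End.hasEigenvalue_of_hasEigenvector
    ⟨Module.End.mem_eigenspace_iff.2 hAy, hy0⟩, ?_⟩
  have hBy : B y = (ν - μ) • (y : V) := by
    simp [hB, hAy, sub_smul]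
  have hDy : D y = (d : ℂ) • (y : V) := Module.End.mem_eigenspace_iff.1 y.2
  have h1 := hquot y
  rw [hDy, hBy, inner_smul_left, inner_self_eq_norm_sq_to_K, norm_smul] at h1
  have h2 : d * ‖(y : V)‖ ^ 2 = (‖ν - μ‖ * ‖(y : V)‖) ^ 2 := by
    rw [← h1]
    simp [← Complex.ofReal_pow, ← Complex.ofReal_mul]
  have hy2 : 0 < ‖(y : V)‖ ^ 2 := by positivity
  have h3 : ‖ν - μ‖ ^ 2 = d := by
    rw [mul_pow] at h2
    exact (mul_right_cancel₀ hy2.ne' h2).symm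
  exact abs_le_of_sq_le_sq' (h3.trans_le hdle) hη0 |>.2

/-- The self-adjoint case of `exists_hasEigenvalue_near`, where the eigenvalue is real. -/
theorem exists_real_hasEigenvalue_near {A : V →ₗ[ℂ] V} (hA : A.IsSymmetric)
    {μ η : ℝ} {z : V} (hz : z ≠ 0) (hη : ‖A z - (μ : ℂ) • z‖ ≤ η * ‖z‖) :
    ∃ ν : ℝ, Module.End.HasEigenvalue A (ν : ℂ) ∧ |ν - μ| ≤ η := by
  have hadj : LinearMap.adjoint A = A := (LinearMap.eq_adjoint_iff A A).2 hA |>.symm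
  obtain ⟨ν, hν, hle⟩ := exists_hasEigenvalue_near (by rw [hadj]) hz hη
  have hreal : ((ν.re : ℝ) : ℂ) = ν := Complex.conj_eq_iff_re.1 (hA.conj_eigenvalue_eq_self hν)
  refine ⟨ν.re, by rwa [hreal], ?_⟩
  rw [← hreal, ← Complex.ofReal_sub, Complex.norm_real] at hle
  exact hle

end normal

/-! ### Linear equations and the propagator -/

section dyson

variable {𝔸 : Type*} [NormedRing 𝔸] [NormedSpace ℝ 𝔸]

/-- The terms of the Dyson series of the linear equation `U' = A U`, `U 0 = 1`. -/
noncomputable def dyson (A : ℝ → 𝔸) : ℕ → ℝ → 𝔸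
  | 0 => fun _ => 1
  | n + 1 => fun t => ∫ s in (0 : ℝ)..t, A s * dyson A n s

variable {A : ℝ → 𝔸}

theorem continuous_dyson [IsBoundedSMul ℝ 𝔸] (hA : Continuous A) (n : ℕ) :
    Continuous (dyson A n) := by
  induction n with
  | zero => exact continuous_const
  | succ n ih =>
    exact intervalIntegral.continuous_primitive
      (fun a b => (hA.mul ih).intervalIntegrable a b) 0

theorem hasDerivAt_dyson [CompleteSpace 𝔸] (hA : Continuous A) (n : ℕ) (t : ℝ) :
    HasDerivAt (dyson A (n + 1)) (A t * dyson A n t) t :=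
  ((hA.mul (continuous_dyson hA n)).integral_hasStrictDerivAt 0 t).hasDerivAt

theorem norm_dyson_le {K : ℝ} (hK : ∀ t, ‖A t‖ ≤ K) (n : ℕ) (t : ℝ) :
    ‖dyson A n t‖ ≤ ‖(1 : 𝔸)‖ * (K ^ n * |t| ^ n / n.factorial) := by
  have hK0 : 0 ≤ K := (norm_nonneg _).trans (hK 0)
  induction n generalizing t with
  | zero => simp [dyson]
  | succ n ih =>
    have hbound : ∀ s, ‖A s * dyson A n s‖ ≤
        ‖(1 : 𝔸)‖ * K ^ (n + 1) / n.factorial * |s| ^ n := by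
      intro s
      refine (norm_mul_le _ _).trans ?_
      refine (mul_le_mul (hK s) (ih s) (norm_nonneg _) hK0).trans (le_of_eq ?_)
      ring
    have hfac : ((n + 1).factorial : ℝ) = (n + 1) * n.factorial := by
      rw [Nat.factorial_succ]; push_cast; ring
    have hn1 : (n : ℝ) + 1 ≠ 0 := by positivity
    have hn2 : (n.factorial : ℝ) ≠ 0 := by positivity
    rcases le_total 0 t with ht | ht
    · refine (intervalIntegral.norm_integral_le_of_norm_le ht
        (g := fun s => ‖(1 : 𝔸)‖ * K ^ (n + 1) / n.factorial * s ^ n)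
        (Filter.Eventually.of_forall fun s hs => ?_)
        ((by fun_prop : Continuous _).intervalIntegrable _ _)).trans (le_of_eq ?_)
      · have := hbound s
        rwa [abs_of_pos hs.1] at this
      · rw [intervalIntegral.integral_const_mul, integral_pow, hfac, abs_of_nonneg ht]
        field_simp
        simp
    · change ‖∫ s in (0 : ℝ)..t, A s * dyson A n s‖ ≤ _
      rw [intervalIntegral.integral_symm, norm_neg]
      refine (intervalIntegral.norm_integral_le_of_norm_le ht
        (g := fun s => ‖(1 : 𝔸)‖ * K ^ (n + 1) / n.factorial * (-s) ^ n)
        (Filter.Eventually.of_forall fun s hs => ?_)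
        ((by fun_prop : Continuous _).intervalIntegrable _ _)).trans (le_of_eq ?_)
      · have := hbound s
        rwa [abs_of_nonpos hs.2] at this
      · rw [intervalIntegral.integral_const_mul,
          intervalIntegral.integral_comp_neg (fun s : ℝ => s ^ n), integral_pow, hfac,
          abs_of_nonpos ht]
        field_simp
        simp

/-- Global solvability of the linear initial value problem `U' = A U`, `U 0 = 1`. -/
theorem exists_hasDerivAt_mul [CompleteSpace 𝔸] (hA : Continuous A) {K : ℝ}
    (hK : ∀ t, ‖A t‖ ≤ K) :
    ∃ U : ℝ → 𝔸, U 0 = 1 ∧ ∀ t, HasDerivAt U (A t * U t) t := by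
  have hK0 : 0 ≤ K := (norm_nonneg _).trans (hK 0)
  have hsum : ∀ R : ℝ, Summable fun n : ℕ => ‖(1 : 𝔸)‖ * (K ^ n * R ^ n / n.factorial) := by
    intro R
    simp_rw [← mul_pow]
    exact (Real.summable_pow_div_factorial (K * R)).mul_left _
  have hsd : ∀ t, Summable fun n => dyson A n t := fun t =>
    Summable.of_norm_bounded (hsum |t|) fun n => norm_dyson_le hK n t
  refine ⟨fun t => 1 + ∑' n, dyson A (n + 1) t, ?_, fun t => ?_⟩
  · simp [dyson]
  · have hmem : t ∈ Metric.ball (0 : ℝ) (|t| + 1) := by simp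
    have h := hasDerivAt_tsum_of_isPreconnected (g := fun n => dyson A (n + 1))
      (g' := fun n t => A t * dyson A n t) ((hsum (|t| + 1)).mul_left K) Metric.isOpen_ball
      (convex_ball (0 : ℝ) (|t| + 1)).isPreconnected (fun n y _ => hasDerivAt_dyson hA n y)
      (fun n y hy => ?_) hmem ((summable_nat_add_iff 1).2 (hsd t)) hmem
    · refine (h.const_add 1).congr_deriv ?_
      rw [(hsd t).tsum_mul_left, (hsd t).tsum_eq_zero_add]
      rfl
    · have hy' : |y| ≤ |t| + 1 := by
        rw [mem_ball_zero_iff, Real.norm_eq_abs] at hy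
        exact hy.le
      refine (norm_mul_le _ _).trans
        (mul_le_mul (hK y) ((norm_dyson_le hK n y).trans ?_) (norm_nonneg _) hK0)
      gcongr

end dyson

section propagator

variable {E : Type*} [NormedAddCommGroup E] [InnerProductSpace ℂ E]
  {M : ℕ} {T : ℝ} {H : ℤ → E →L[ℂ] E}

theorem freq_mul_period (hT : 0 < T) : freq T * T = 2 * Real.pi := by
  rw [freq]; field_simp

theorem freq_pos (hT : 0 < T) : 0 < freq T := by
  have := Real.pi_pos
  rw [freq]; positivity

theorem exp_freq_add_period (hT : 0 < T) (m : ℤ) (t : ℝ) :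
    Complex.exp (-Complex.I * (m : ℂ) * (freq T : ℂ) * ((t + T : ℝ) : ℂ)) =
      Complex.exp (-Complex.I * (m : ℂ) * (freq T : ℂ) * (t : ℂ)) := by
  have h : (freq T : ℂ) * (T : ℂ) = 2 * (Real.pi : ℂ) := by
    exact_mod_cast congrArg (fun x : ℝ => (x : ℂ)) (freq_mul_period hT)
  rw [Complex.exp_eq_exp_iff_exists_int]
  refine ⟨-m, ?_⟩
  push_cast
  linear_combination (-Complex.I * (m : ℂ)) * h

theorem hamiltonian_add_period (hT : 0 < T) (t : ℝ) :
    hamiltonian M T H (t + T) = hamiltonian M T H t := by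
  simp only [hamiltonian, exp_freq_add_period hT]

theorem continuous_hamiltonian : Continuous (hamiltonian M T H) := by
  unfold hamiltonian
  fun_prop

theorem norm_phase (m : ℤ) (w t : ℝ) :
    ‖Complex.exp (-Complex.I * (m : ℂ) * (w : ℂ) * (t : ℂ))‖ = 1 := by
  rw [Complex.norm_exp]
  simp

theorem norm_hamiltonian_le (t : ℝ) :
    ‖hamiltonian M T H t‖ ≤ ∑ m ∈ Finset.Icc (-(M : ℤ)) M, ‖H m‖ := by
  refine norm_sum_le_of_le _ fun m _ => ?_
  rw [norm_smul, norm_phase, one_mul]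

theorem mul_star_self_of_star_mul_self [FiniteDimensional ℂ E] [CompleteSpace E] {V : E →L[ℂ] E}
    (h : star V * V = 1) : V * star V = 1 := by
  have h1 : (star V).toLinearMap * V.toLinearMap = 1 :=
    LinearMap.ext fun x => congrArg (fun F : E →L[ℂ] E => F x) h
  exact ContinuousLinearMap.ext fun x => LinearMap.congr_fun (mul_eq_one_comm.1 h1) x

/-- The propagator of the Schrödinger equation: it is unitary, and by periodicity of `H(t)` it
factors through the monodromy operator `U T`. -/
theorem exists_propagator [FiniteDimensional ℂ E] (hT : 0 < T)
    (hH : ∀ t : ℝ, (hamiltonian M T H t : E →ₗ[ℂ] E).IsSymmetric) :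
    ∃ U : ℝ → E →L[ℂ] E,
      (∀ t, HasDerivAt U (-Complex.I • hamiltonian M T H t * U t) t) ∧
      (∀ t, star (U t) * U t = 1) ∧ ∀ t, U (t + T) = U t * U T := by
  have : CompleteSpace E := FiniteDimensional.complete ℂ E
  have hstar : ∀ t, star (hamiltonian M T H t) = hamiltonian M T H t := fun t =>
    (ContinuousLinearMap.isSelfAdjoint_iff_isSymmetric.2 (hH t)).star_eq
  obtain ⟨U, hU0, hU⟩ := exists_hasDerivAt_mul
    (A := fun t => -Complex.I • hamiltonian M T H t)
    (continuous_hamiltonian.const_smul (-Complex.I)) (K := ∑ m ∈ Finset.Icc (-(M : ℤ)) M, ‖H m‖)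
    (fun t => by rw [norm_smul]; simpa using norm_hamiltonian_le t)
  -- `U† U(· + s)` is constant as soon as the shift `s` leaves `H(t)` invariant
  have hconst : ∀ s, (∀ t, hamiltonian M T H (t + s) = hamiltonian M T H t) →
      ∀ t, star (U t) * U (t + s) = U s := by
    intro s hs t
    have hd : ∀ t, HasDerivAt (fun t => star (U t) * U (t + s)) 0 t := by
      intro t
      have h1 := (hU t).star
      have h2 := (hU (t + s)).comp_add_const t s
      refine (h1.mul h2).congr_deriv ?_
      simp only [star_mul, star_smul, hstar, hs]
      simp [mul_assoc]
    have := is_const_of_deriv_eq_zero (fun t => (hd t).differentiableAt) (fun t => (hd t).deriv) t 0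
    simpa [hU0] using this
  have hunit : ∀ t, star (U t) * U t = 1 := fun t => by
    simpa [hU0] using hconst 0 (by simp) t
  refine ⟨U, hU, hunit, fun t => ?_⟩
  rw [← hconst T (hamiltonian_add_period hT) t, ← mul_assoc,
    mul_star_self_of_star_mul_self (hunit t), one_mul]

end propagator

/-! ### Fourier modes and Floquet eigenvectors -/

section phase

theorem hasDerivAt_cexp_mul_ofReal (c : ℂ) (t : ℝ) :
    HasDerivAt (fun s : ℝ => Complex.exp (c * (s : ℂ))) (c * Complex.exp (c * (t : ℂ))) t := by
  refine ((hasDerivAt_id t).ofReal_comp.const_mul c).cexp.congr_deriv ?_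
  simp [mul_comm]

/-- The Fourier mode `e^{-imωt}`. -/
noncomputable def phase (T : ℝ) (m : ℤ) (t : ℝ) : ℂ :=
  Complex.exp (-Complex.I * (m : ℂ) * (freq T : ℂ) * (t : ℂ))

variable {T : ℝ}

theorem norm_phase_eq_one (m : ℤ) (t : ℝ) : ‖phase T m t‖ = 1 := norm_phase m (freq T) t

@[simp] theorem phase_zero_left (t : ℝ) : phase T 0 t = 1 := by simp [phase]

theorem phase_mul (m n : ℤ) (t : ℝ) : phase T m t * phase T n t = phase T (m + n) t := by
  rw [phase, phase, phase, ← Complex.exp_add]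
  push_cast
  ring_nf

theorem conj_phase (m : ℤ) (t : ℝ) : starRingEnd ℂ (phase T m t) = phase T (-m) t := by
  rw [phase, phase, ← Complex.exp_conj]
  simp

theorem phase_add_period (hT : 0 < T) (m : ℤ) (t : ℝ) : phase T m (t + T) = phase T m t :=
  exp_freq_add_period hT m t

@[fun_prop]
theorem continuous_phase (m : ℤ) : Continuous (phase T m) := by
  unfold phase
  fun_prop

theorem hasDerivAt_phase (m : ℤ) (t : ℝ) :
    HasDerivAt (phase T m) (-Complex.I * (m : ℂ) * (freq T : ℂ) * phase T m t) t :=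
  hasDerivAt_cexp_mul_ofReal _ t

theorem integral_phase (hT : 0 < T) (m : ℤ) :
    ∫ t in (0 : ℝ)..T, phase T m t = if m = 0 then (T : ℂ) else 0 := by
  split_ifs with hm
  · simp [hm]
  · have hc : -Complex.I * (m : ℂ) * (freq T : ℂ) ≠ 0 := by
      have h1 : (freq T : ℂ) ≠ 0 := by exact_mod_cast (freq_pos hT).ne'
      have h2 : (m : ℂ) ≠ 0 := by exact_mod_cast hm
      simp [h1, h2]
    simp only [phase]
    rw [integral_exp_mul_complex hc]
    have h3 := phase_add_period hT m 0
    simp only [phase, zero_add] at h3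
    rw [h3, sub_self, zero_div]

/-- Orthogonality of the Fourier modes. -/
theorem integral_phase_mul_sum (hT : 0 < T) (S : Finset ℤ) (c : ℤ → ℂ) (k : ℤ) :
    ∫ t in (0 : ℝ)..T, phase T (-k) t * ∑ m ∈ S, phase T m t * c m =
      if k ∈ S then T * c k else 0 := by
  have h1 : ∀ t, phase T (-k) t * ∑ m ∈ S, phase T m t * c m =
      ∑ m ∈ S, phase T (m - k) t * c m := by
    intro t
    rw [Finset.mul_sum]
    refine Finset.sum_congr rfl fun m _ => ?_
    rw [← mul_assoc, phase_mul, neg_add_eq_sub]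
  simp_rw [h1]
  rw [intervalIntegral.integral_finsetSum
    fun m _ => (by fun_prop : Continuous _).intervalIntegrable _ _]
  simp_rw [intervalIntegral.integral_mul_const, integral_phase hT, sub_eq_zero, ite_mul, zero_mul]
  rw [Finset.sum_ite_eq']

end phase

section coefficients

variable {E : Type*} [NormedAddCommGroup E] [InnerProductSpace ℂ E]
  {M : ℕ} {T : ℝ} {H : ℤ → E →L[ℂ] E}

/-- Hermiticity of `H(t)` for all `t` means `H_m† = H_{-m}`. -/
theorem inner_coeff_left (hT : 0 < T)
    (hH : ∀ t : ℝ, (hamiltonian M T H t : E →ₗ[ℂ] E).IsSymmetric) {k : ℤ} (hk : |k| ≤ (M : ℤ))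
    (x y : E) : inner ℂ (H k x) y = inner ℂ x (H (-k) y) := by
  have h1 : ∀ t, ∑ m ∈ Finset.Icc (-(M : ℤ)) M, phase T m t * inner ℂ x (H m y) =
      ∑ m ∈ Finset.Icc (-(M : ℤ)) M, phase T m t * inner ℂ (H (-m) x) y := by
    intro t
    have h := hH t x y
    simp only [ContinuousLinearMap.coe_coe, hamiltonian, sum_apply,
      smul_apply, sum_inner, inner_sum, inner_smul_left, inner_smul_right] at h
    refine Eq.trans h.symm ?_
    refine Finset.sum_nbij' (fun m => -m) (fun m => -m) ?_ ?_ ?_ ?_ ?_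
    · intro m hm; simp only [Finset.mem_Icc] at hm ⊢; omega
    · intro m hm; simp only [Finset.mem_Icc] at hm ⊢; omega
    · simp
    · simp
    · intro m _
      rw [neg_neg]
      exact congrArg (· * _) (conj_phase m t)
  have hmem : -k ∈ Finset.Icc (-(M : ℤ)) M := by
    rw [abs_le] at hk
    rw [Finset.mem_Icc]; omega
  have h2 := integral_phase_mul_sum hT (Finset.Icc (-(M : ℤ)) M) (fun m => inner ℂ x (H m y)) (-k)
  have h3 := integral_phase_mul_sum hT (Finset.Icc (-(M : ℤ)) M)
    (fun m => inner ℂ (H (-m) x) y) (-k)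
  simp_rw [h1] at h2
  rw [h2, if_pos hmem, if_pos hmem, neg_neg] at h3
  exact (mul_left_cancel₀ (by exact_mod_cast hT.ne') h3).symm

/-- The coefficient of `e^{-ikωt}` in the Fourier series of a `T`-periodic function. The sign of the
mode is that of `hamiltonian`, opposite to Mathlib's `fourierCoeff`. -/
noncomputable def modeCoeff (T : ℝ) (φ : ℝ → E) (k : ℤ) : E :=
  (1 / (T : ℂ)) • ∫ t in (0 : ℝ)..T, phase T (-k) t • φ t

/-- A continuous periodic function with vanishing Fourier coefficients is zero. -/
theorem eq_zero_of_modeCoeff_eq_zero [FiniteDimensional ℂ E] (hT : 0 < T) {φ : ℝ → E}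
    (hφ : Continuous φ) (hper : Function.Periodic φ T) (h0 : ∀ k, modeCoeff T φ k = 0) : φ = 0 := by
  have : CompleteSpace E := FiniteDimensional.complete ℂ E
  have : Fact (0 < T) := ⟨hT⟩
  have hTc : (T : ℂ) ≠ 0 := by exact_mod_cast hT.ne'
  funext s
  refine ext_inner_left ℂ fun y => ?_
  rw [Pi.zero_apply, inner_zero_right]
  have hper' : Function.Periodic (fun t => inner ℂ y (φ t)) T := fun t => by
    simp only [hper t]
  have hc : Continuous hper'.lift :=
    (QuotientAddGroup.isQuotientMap_mk (N := AddSubgroup.zmultiples T)).continuous_iff.2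
      (continuous_const.inner hφ)
  set F : C(AddCircle T, ℂ) := ⟨hper'.lift, hc⟩ with hF
  have hFapp : ∀ t : ℝ, F (t : AddCircle T) = inner ℂ y (φ t) := fun t =>
    hper'.lift_coe t
  have hcoeff : ∀ n, fourierCoeff F n = 0 := by
    intro n
    rw [fourierCoeff_eq_intervalIntegral F n 0]
    have hi : ∫ t in (0 : ℝ)..T, phase T n t • φ t = 0 := by
      have := h0 (-n)
      rw [modeCoeff, neg_neg] at this
      exact (smul_eq_zero.1 this).resolve_left (one_div_ne_zero hTc)
    have hpt : ∀ t : ℝ, fourier (-n) (t : AddCircle T) • F (t : AddCircle T) =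
        innerSL ℂ y (phase T n t • φ t) := by
      intro t
      rw [hFapp, fourier_coe_apply, innerSL_apply_apply, inner_smul_right, smul_eq_mul]
      congr 1
      rw [phase, freq]
      push_cast
      congr 1
      field_simp
    simp_rw [hpt, zero_add]
    rw [ContinuousLinearMap.intervalIntegral_comp_comm (innerSL ℂ y)
      ((by fun_prop : Continuous fun t => phase T n t • φ t).intervalIntegrable _ _), hi]
    simp
  have hsum := has_pointwise_sum_fourier_series_of_summable (f := F)
    (by rw [show fourierCoeff F = fun _ => 0 from funext hcoeff]; exact summable_zero)
    (s : AddCircle T)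
  simp only [hcoeff, zero_smul] at hsum
  rw [← hFapp]
  exact hsum.unique hasSum_zero

/-- The Fourier coefficients of a Floquet mode form a nonzero `ℓ²` eigenvector of the untruncated
Floquet Hamiltonian. -/
theorem exists_floquet_eigenvector [FiniteDimensional ℂ E] (hT : 0 < T) {ε : ℝ}
    (hε : IsQuasienergy M T H ε) :
    ∃ a : ℤ → E, (Summable fun k => ‖a k‖ ^ 2) ∧ (∃ k, a k ≠ 0) ∧
      ∀ k, ∑ m ∈ Finset.Icc (-(M : ℤ)) M, H m (a (k - m)) =
        (((k : ℝ) * freq T + ε : ℝ) : ℂ) • a k := by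
  have : CompleteSpace E := FiniteDimensional.complete ℂ E
  have hTc : (T : ℂ) ≠ 0 := by exact_mod_cast hT.ne'
  obtain ⟨φ, hφ0, hper, hψ⟩ := hε
  have hφd : ∀ t, HasDerivAt φ
      ((Complex.I * ε) • φ t - Complex.I • hamiltonian M T H t (φ t)) t := by
    intro t
    have he : HasDerivAt (fun s : ℝ => Complex.exp (Complex.I * (ε : ℂ) * (s : ℂ)))
        (Complex.I * ε * Complex.exp (Complex.I * (ε : ℂ) * (t : ℂ))) t :=
      hasDerivAt_cexp_mul_ofReal _ t
    have hinv : ∀ s : ℝ, Complex.exp (Complex.I * (ε : ℂ) * (s : ℂ)) *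
        Complex.exp (-Complex.I * (ε : ℂ) * (s : ℂ)) = 1 := by
      intro s
      rw [← Complex.exp_add]
      simp
    have h := he.smul (hψ t)
    have hfun : (fun s : ℝ => Complex.exp (Complex.I * (ε : ℂ) * (s : ℂ)) •
        Complex.exp (-Complex.I * (ε : ℂ) * (s : ℂ)) • φ s) = φ := by
      funext s
      rw [smul_smul, hinv, one_smul]
    have h' : HasDerivAt (fun s : ℝ => Complex.exp (Complex.I * (ε : ℂ) * (s : ℂ)) •
        Complex.exp (-Complex.I * (ε : ℂ) * (s : ℂ)) • φ s) _ t := h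
    rw [hfun] at h'
    refine h'.congr_deriv ?_
    rw [map_smul]
    linear_combination (norm := module)
      hinv t • ((Complex.I * (ε : ℂ)) • φ t - Complex.I • hamiltonian M T H t (φ t))
  have hφc : Continuous φ := continuous_iff_continuousAt.2 fun t => (hφd t).continuousAt
  set a : ℤ → E := modeCoeff T φ with ha
  have hint : ∀ k, IntervalIntegrable (fun t => phase T k t • φ t) MeasureTheory.volume 0 T :=
    fun k => (by fun_prop : Continuous _).intervalIntegrable _ _
  have heig : ∀ k, ∑ m ∈ Finset.Icc (-(M : ℤ)) M, H m (a (k - m)) =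
        (((k : ℝ) * freq T + ε : ℝ) : ℂ) • a k := by
    intro k
    have hgd : ∀ t, HasDerivAt (fun t => phase T (-k) t • φ t)
        (Complex.I • ((((k : ℝ) * freq T + ε : ℝ) : ℂ) • (phase T (-k) t • φ t) -
          ∑ m ∈ Finset.Icc (-(M : ℤ)) M, H m (phase T (-(k - m)) t • φ t))) t := by
      intro t
      refine ((hasDerivAt_phase (-k) t).smul (hφd t)).congr_deriv ?_
      have hs : ∑ m ∈ Finset.Icc (-(M : ℤ)) M, H m (phase T (-(k - m)) t • φ t) =
          phase T (-k) t • hamiltonian M T H t (φ t) := by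
        rw [hamiltonian, sum_apply, Finset.smul_sum]
        refine Finset.sum_congr rfl fun m _ => ?_
        rw [map_smul, smul_apply, smul_smul]
        congr 1
        rw [show -(k - m) = -k + m by ring, ← phase_mul]
        rfl
      rw [hs]
      push_cast
      module
    have hcont : Continuous fun t => Complex.I • ((((k : ℝ) * freq T + ε : ℝ) : ℂ) •
        (phase T (-k) t • φ t) -
          ∑ m ∈ Finset.Icc (-(M : ℤ)) M, H m (phase T (-(k - m)) t • φ t)) := by
      fun_prop
    -- the derivative of a periodic function integrates to zero over a period
    have hftc := intervalIntegral.integral_eq_sub_of_hasDerivAt (fun t _ => hgd t)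
      (hcont.intervalIntegrable 0 T)
    have hend : phase T (-k) T • φ T - phase T (-k) 0 • φ 0 = 0 := by
      have h1 := phase_add_period hT (-k) 0
      have h2 := hper 0
      rw [zero_add] at h1 h2
      rw [h1, h2, sub_self]
    rw [hend, intervalIntegral.integral_smul, smul_eq_zero, or_iff_right Complex.I_ne_zero,
      intervalIntegral.integral_sub, intervalIntegral.integral_smul, sub_eq_zero,
      intervalIntegral.integral_finsetSum] at hftc
    · have hHm : ∀ m : ℤ, ∫ t in (0 : ℝ)..T, H m (phase T (-(k - m)) t • φ t) =
          H m (∫ t in (0 : ℝ)..T, phase T (-(k - m)) t • φ t) := fun m =>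
        ContinuousLinearMap.intervalIntegral_comp_comm (H m) (hint _)
      simp_rw [hHm] at hftc
      simp only [ha, modeCoeff, map_smul]
      rw [← Finset.smul_sum, ← hftc, smul_comm]
    · exact fun m _ => (by fun_prop : Continuous _).intervalIntegrable _ _
    · exact (by fun_prop : Continuous _).intervalIntegrable _ _
    · exact (by fun_prop : Continuous _).intervalIntegrable _ _
  obtain ⟨C, hC⟩ := isCompact_Icc.exists_bound_of_continuousOn (s := Set.Icc 0 T) hφc.continuousOn
  have hC0 : 0 ≤ C := (norm_nonneg _).trans (hC 0 ⟨le_rfl, hT.le⟩)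
  have hle : ∀ k, ‖a k‖ ≤ C := by
    intro k
    have h1 : ‖∫ t in (0 : ℝ)..T, phase T (-k) t • φ t‖ ≤ C * |T - 0| := by
      refine intervalIntegral.norm_integral_le_of_norm_le_const fun t ht => ?_
      rw [Set.uIoc_of_le hT.le] at ht
      rw [norm_smul, norm_phase_eq_one, one_mul]
      exact hC t ⟨ht.1.le, ht.2⟩
    simp only [ha, modeCoeff]
    rw [norm_smul, norm_div, norm_one, Complex.norm_real, Real.norm_of_nonneg hT.le, one_div,
      inv_mul_le_iff₀ hT]
    rwa [sub_zero, abs_of_pos hT, mul_comm] at h1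
  refine ⟨a, ?_, ?_, heig⟩
  · -- the eigenvector equation turns the bound `C` into the decay `‖a k‖ = O(1 / |k|)`
    set B : ℝ := (∑ m ∈ Finset.Icc (-(M : ℤ)) M, ‖H m‖) * C + |ε| * C with hB
    have hB0 : 0 ≤ B := by
      have := Finset.sum_nonneg fun m (_ : m ∈ Finset.Icc (-(M : ℤ)) M) => norm_nonneg (H m)
      positivity
    have hω := freq_pos hT
    have hk : ∀ k : ℤ, |(k : ℝ)| * freq T * ‖a k‖ ≤ B := by
      intro k
      have h1 : (((k : ℝ) * freq T : ℝ) : ℂ) • a k =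
          ∑ m ∈ Finset.Icc (-(M : ℤ)) M, H m (a (k - m)) - (ε : ℂ) • a k := by
        rw [heig, ← sub_smul]
        push_cast
        congr 1
        ring
      have h2 := congrArg norm h1
      rw [norm_smul, Complex.norm_real, Real.norm_eq_abs, abs_mul, abs_of_pos hω] at h2
      rw [h2]
      refine (norm_sub_le _ _).trans (add_le_add ?_ ?_)
      · rw [Finset.sum_mul]
        refine norm_sum_le_of_le _ fun m _ => ?_
        exact ((H m).le_opNorm _).trans (mul_le_mul_of_nonneg_left (hle _) (norm_nonneg _))
      · rw [norm_smul, Complex.norm_real, Real.norm_eq_abs]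
        exact mul_le_mul_of_nonneg_left (hle _) (abs_nonneg _)
    have hsum : Summable fun k : ℤ => (B / freq T) ^ 2 * (1 / (k : ℝ) ^ 2) +
        if k = 0 then C ^ 2 else 0 :=
      ((Real.summable_one_div_int_pow.2 one_lt_two).mul_left _).add
        (hasSum_ite_eq (0 : ℤ) (C ^ 2)).summable
    refine Summable.of_nonneg_of_le (fun k => sq_nonneg _) (fun k => ?_) hsum
    rcases eq_or_ne k 0 with rfl | hk0
    · simpa using pow_le_pow_left₀ (norm_nonneg _) (hle 0) 2
    · have hkpos : 0 < |(k : ℝ)| := abs_pos.2 (by exact_mod_cast hk0)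
      rw [if_neg hk0, add_zero, ← sq_abs (k : ℝ), ← one_div_pow, ← mul_pow]
      refine pow_le_pow_left₀ (norm_nonneg _) ?_ 2
      rw [mul_one_div, div_div, le_div_iff₀ (by positivity)]
      linarith [hk k]
  · by_contra hne
    push Not at hne
    exact hφ0 (eq_zero_of_modeCoeff_eq_zero hT hφc hper hne)

end coefficients

/-! ### From quasienergies to eigenvalues of the truncation -/

section truncate

variable {E : Type*} [NormedAddCommGroup E] {M L : ℕ}

theorem card_Icc_neg_self (M : ℕ) : ((Finset.Icc (-(M : ℤ)) M).card : ℝ) = 2 * M + 1 := by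
  rw [Int.card_Icc]
  have : ((M : ℤ) + 1 - -(M : ℤ)).toNat = 2 * M + 1 := by omega
  rw [this]
  push_cast
  ring

/-- A shift by `m` moves at most `|m|` points of `[L]` out of `[L]`. -/
theorem sum_shift_out_le {m : ℤ} (hm : m ∈ Finset.Icc (-(M : ℤ)) M) {B : ℝ} (hB : 0 ≤ B) :
    ∑ j ∈ indices L, (if j + m ∈ indices L then 0 else B) ≤ M * B := by
  rw [Finset.mem_Icc] at hm
  have hsub : (indices L).filter (fun j => j + m ∉ indices L) ⊆
      Finset.Icc (-(L : ℤ) + 1) (-(L : ℤ) - m) ∪ Finset.Icc ((L : ℤ) - m + 1) L := by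
    intro j
    simp only [indices, Finset.mem_filter, Finset.mem_union, Finset.mem_Icc]
    omega
  have hcard : ((indices L).filter (fun j => j + m ∉ indices L)).card ≤ M := by
    refine (Finset.card_le_card hsub).trans ((Finset.card_union_le _ _).trans ?_)
    rw [Int.card_Icc, Int.card_Icc]
    omega
  have h1 : ∑ j ∈ indices L, (if j + m ∈ indices L then 0 else B) =
      ((indices L).filter (fun j => j + m ∉ indices L)).card * B := by
    rw [← nsmul_eq_mul, ← Finset.sum_const, Finset.sum_filter]
    exact Finset.sum_congr rfl fun j _ => by split_ifs <;> simp_all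
  rw [h1]
  exact mul_le_mul_of_nonneg_right (by exact_mod_cast hcard) hB

/-- The restriction of a family on `ℤ` to the truncated Sambe space. -/
noncomputable def truncate (L : ℕ) (w : ℤ → E) : TruncSambe E L :=
  WithLp.toLp 2 fun j : indices L => w j

theorem norm_truncate_sq (w : ℤ → E) : ‖truncate L w‖ ^ 2 = ∑ j ∈ indices L, ‖w j‖ ^ 2 := by
  rw [PiLp.norm_sq_eq_of_L2]
  exact Finset.sum_coe_sort (indices L) fun j => ‖w j‖ ^ 2

theorem norm_le_sum_norm (u : TruncSambe E L) : ‖u‖ ≤ ∑ j, ‖u j‖ := by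
  refine abs_le_of_sq_le_sq' ?_ (Finset.sum_nonneg fun j _ => norm_nonneg _) |>.2
  rw [PiLp.norm_sq_eq_of_L2]
  exact Finset.sum_sq_le_sq_sum_of_nonneg fun j _ => norm_nonneg _

end truncate

section truncation

variable {E : Type*} [NormedAddCommGroup E] [InnerProductSpace ℂ E]
  {M : ℕ} {T α : ℝ} {H : ℤ → E →L[ℂ] E} {L : ℕ}

theorem truncHamiltonian_truncate (w : ℤ → E) (j : indices L) :
    truncHamiltonian M T H L (truncate L w) j =
      (∑ m ∈ Finset.Icc (-(M : ℤ)) M,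
        if (j : ℤ) - m ∈ indices L then H m (w (j - m)) else 0) -
          (((j : ℤ) : ℂ) * (freq T : ℂ)) • w j := by
  change (∑ l : indices L, if |(j : ℤ) - (l : ℤ)| ≤ (M : ℤ) then H ((j : ℤ) - (l : ℤ)) (w l)
    else 0) - _ = _
  congr 1
  rw [Finset.sum_coe_sort (indices L)
    (fun l : ℤ => if |(j : ℤ) - l| ≤ (M : ℤ) then H ((j : ℤ) - l) (w l) else 0),
    ← Finset.sum_filter, ← Finset.sum_filter]
  refine Finset.sum_nbij' (fun l => (j : ℤ) - l) (fun m => (j : ℤ) - m) ?_ ?_ ?_ ?_ ?_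
  · intro l
    simp only [Finset.mem_filter, Finset.mem_Icc, abs_le, sub_sub_cancel]
    tauto
  · intro m
    simp only [Finset.mem_filter, Finset.mem_Icc, abs_le, sub_sub_cancel]
    tauto
  · simp
  · simp
  · simp

theorem isSymmetric_truncHamiltonian (hT : 0 < T)
    (hH : ∀ t : ℝ, (hamiltonian M T H t : E →ₗ[ℂ] E).IsSymmetric) (L : ℕ) :
    (truncHamiltonian M T H L).IsSymmetric := by
  intro x y
  rw [PiLp.inner_apply, PiLp.inner_apply]
  change ∑ j : indices L, inner ℂ ((∑ l : indices L,
      if |(j : ℤ) - (l : ℤ)| ≤ (M : ℤ) then H ((j : ℤ) - (l : ℤ)) (x l) else 0) -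
        (((j : ℤ) : ℂ) * (freq T : ℂ)) • x j) (y j) =
    ∑ j : indices L, inner ℂ (x j) ((∑ l : indices L,
      if |(j : ℤ) - (l : ℤ)| ≤ (M : ℤ) then H ((j : ℤ) - (l : ℤ)) (y l) else 0) -
        (((j : ℤ) : ℂ) * (freq T : ℂ)) • y j)
  simp only [inner_sub_left, inner_sub_right, sum_inner, inner_sum, Finset.sum_sub_distrib]
  congr 1
  · rw [Finset.sum_comm]
    refine Finset.sum_congr rfl fun l _ => Finset.sum_congr rfl fun j _ => ?_
    rw [abs_sub_comm (l : ℤ)]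
    split_ifs with h
    · rw [inner_coeff_left hT hH h, neg_sub]
    · simp
  · refine Finset.sum_congr rfl fun j _ => ?_
    rw [inner_smul_left, inner_smul_right]
    simp

/-- The scalar decay inequality satisfied by the norms of an eigenvector of the Floquet
Hamiltonian. -/
theorem decay_hypothesis (hT : 0 < T) (hα : ∀ m : ℤ, |m| ≤ (M : ℤ) → ‖H m‖ ≤ α) {ε : ℝ}
    {a : ℤ → E} {k : ℤ} (h : ∑ m ∈ Finset.Icc (-(M : ℤ)) M, H m (a (k - m)) =
        (((k : ℝ) * freq T + ε : ℝ) : ℂ) • a k) :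
    freq T * |(k : ℝ) + ε / freq T| * ‖a k‖ ^ 2 ≤
      α * (‖a k‖ * ∑ m ∈ Finset.Icc (-(M : ℤ)) M, ‖a (k - m)‖) := by
  have hω := freq_pos hT
  have h1 : freq T * |(k : ℝ) + ε / freq T| = |(k : ℝ) * freq T + ε| := by
    rw [← abs_of_pos hω, ← abs_mul, abs_of_pos hω]
    congr 1
    field_simp
  have h2 := congrArg norm h
  rw [norm_smul, Complex.norm_real, Real.norm_eq_abs] at h2
  have h3 : ‖∑ m ∈ Finset.Icc (-(M : ℤ)) M, H m (a (k - m))‖ ≤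
      α * ∑ m ∈ Finset.Icc (-(M : ℤ)) M, ‖a (k - m)‖ := by
    rw [Finset.mul_sum]
    refine norm_sum_le_of_le _ fun m hm => ?_
    exact (H m).le_of_opNorm_le (hα m (abs_le.2 (Finset.mem_Icc.1 hm))) _
  rw [h2] at h3
  rw [h1]
  have := mul_le_mul_of_nonneg_right h3 (norm_nonneg (a k))
  linarith

theorem nonneg_of_norm_le (hα : ∀ m : ℤ, |m| ≤ (M : ℤ) → ‖H m‖ ≤ α) : 0 ≤ α :=
  (norm_nonneg _).trans (hα 0 (by simp))

/-- An eigenvalue in the zeroth Brillouin zone is bounded by `(2M + 1) α`: compare norms at an index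
where the eigenvector is largest. -/
theorem abs_le_of_floquet_eigenvector (hT : 0 < T)
    (hα : ∀ m : ℤ, |m| ≤ (M : ℤ) → ‖H m‖ ≤ α) {ε : ℝ} (hε : ε ∈ brillouinZone T) {a : ℤ → E}
    (hs : Summable fun k => ‖a k‖ ^ 2) (hne : ∃ k, a k ≠ 0)
    (h : ∀ k, ∑ m ∈ Finset.Icc (-(M : ℤ)) M, H m (a (k - m)) =
        (((k : ℝ) * freq T + ε : ℝ) : ℂ) • a k) : |ε| ≤ (2 * M + 1) * α := by
  have hω := freq_pos hT
  have hα0 := nonneg_of_norm_le hα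
  obtain ⟨k₀, hk₀⟩ := hne
  have hk₀' : 0 < ‖a k₀‖ ^ 2 := by have := norm_pos_iff.2 hk₀; positivity
  have hfin : {k | ‖a k₀‖ ^ 2 ≤ ‖a k‖ ^ 2}.Finite := by
    have := hs.tendsto_cofinite_zero.eventually (gt_mem_nhds hk₀')
    rw [Filter.eventually_cofinite] at this
    exact this.subset fun k hk => not_lt.2 hk
  obtain ⟨k, hk, hmax⟩ := hfin.exists_maximalFor (fun k => ‖a k‖ ^ 2) _ ⟨k₀, le_refl (‖a k₀‖ ^ 2)⟩
  have hle : ∀ j, ‖a j‖ ≤ ‖a k‖ := by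
    intro j
    refine abs_le_of_sq_le_sq' ?_ (norm_nonneg _) |>.2
    rcases le_total (‖a k₀‖ ^ 2) (‖a j‖ ^ 2) with hj | hj
    · rcases le_total (‖a j‖ ^ 2) (‖a k‖ ^ 2) with hjk | hjk
      · exact hjk
      · exact hmax hj hjk
    · exact hj.trans hk
  have hkpos : 0 < ‖a k‖ := (norm_pos_iff.2 hk₀).trans_le (hle k₀)
  have h1 := decay_hypothesis hT hα (h k)
  have h2 : ∑ m ∈ Finset.Icc (-(M : ℤ)) M, ‖a (k - m)‖ ≤ (2 * M + 1) * ‖a k‖ := by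
    rw [← card_Icc_neg_self, ← nsmul_eq_mul, ← Finset.sum_const]
    exact Finset.sum_le_sum fun m _ => hle _
  have h3 : |ε / freq T| ≤ |(k : ℝ) + ε / freq T| := by
    have hlo : -(1 / 2) ≤ ε / freq T := by
      rw [le_div_iff₀ hω]; linarith [hε.1]
    have hhi : ε / freq T ≤ 1 / 2 := by
      rw [div_le_iff₀ hω]; linarith [hε.2]
    rcases lt_trichotomy k 0 with hk0 | hk0 | hk0
    · have : (k : ℝ) ≤ -1 := by exact_mod_cast Int.le_sub_one_of_lt hk0
      rw [abs_le]
      rw [abs_of_nonpos (by linarith : (k : ℝ) + ε / freq T ≤ 0)]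
      constructor <;> linarith
    · simp [hk0]
    · have : (1 : ℝ) ≤ k := by exact_mod_cast hk0
      rw [abs_le]
      rw [abs_of_nonneg (by linarith : 0 ≤ (k : ℝ) + ε / freq T)]
      constructor <;> linarith
  have h4 : |ε| = freq T * |ε / freq T| := by
    rw [abs_div, abs_of_pos hω]; field_simp
  have h5 : |ε| * ‖a k‖ ^ 2 ≤ (2 * M + 1) * α * ‖a k‖ ^ 2 := by
    have h6 := mul_le_mul_of_nonneg_right (mul_le_mul_of_nonneg_left h3 hω.le) (sq_nonneg ‖a k‖)
    rw [← h4] at h6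
    have h7 := mul_le_mul_of_nonneg_left (mul_le_mul_of_nonneg_left h2 hkpos.le) hα0
    calc _ ≤ _ := h6
      _ ≤ _ := h1
      _ ≤ _ := h7
      _ = _ := by ring
  exact le_of_mul_le_mul_right h5 (by positivity)

/-- `H_F^L` has an eigenvalue within its off-diagonal norm of each diagonal entry. -/
theorem exists_truncEigenvalue_near_diagonal [FiniteDimensional ℂ E] [Nontrivial E] (hT : 0 < T)
    (hH : ∀ t : ℝ, (hamiltonian M T H t : E →ₗ[ℂ] E).IsSymmetric)
    (hα : ∀ m : ℤ, |m| ≤ (M : ℤ) → ‖H m‖ ≤ α) {l : ℤ} (hl : l ∈ indices L) :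
    ∃ x : ℝ, IsTruncEigenvalue M T H L x ∧ |x + l * freq T| ≤ (2 * M + 1) * α := by
  have hα0 := nonneg_of_norm_le hα
  obtain ⟨v, hv⟩ := exists_ne (0 : E)
  set w : ℤ → E := fun j => if j = l then v else 0 with hw
  have hwl : ‖v‖ ≤ ‖truncate L w‖ := by
    refine abs_le_of_sq_le_sq' ?_ (norm_nonneg _) |>.2
    rw [norm_truncate_sq]
    refine le_trans (le_of_eq ?_)
      (Finset.single_le_sum (f := fun j => ‖w j‖ ^ 2) (fun j _ => sq_nonneg _) hl)
    simp [hw]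
  have hvpos := norm_pos_iff.2 hv
  have hres : ‖truncHamiltonian M T H L (truncate L w) -
      ((-(l * freq T) : ℝ) : ℂ) • truncate L w‖ ≤ (2 * M + 1) * α * ‖truncate L w‖ := by
    have hcomp : ∀ j : indices L, ‖(truncHamiltonian M T H L (truncate L w) -
        ((-(l * freq T) : ℝ) : ℂ) • truncate L w) j‖ ≤
        ∑ m ∈ Finset.Icc (-(M : ℤ)) M, if (j : ℤ) = l + m then α * ‖v‖ else 0 := by
      intro j
      rw [PiLp.sub_apply, PiLp.smul_apply, truncHamiltonian_truncate]
      have hdiag : (((j : ℤ) : ℂ) * (freq T : ℂ)) • w j +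
          ((-(l * freq T) : ℝ) : ℂ) • truncate L w j = 0 := by
        change _ + ((-(l * freq T) : ℝ) : ℂ) • w j = 0
        rw [← add_smul]
        by_cases hj : (j : ℤ) = l
        · rw [hj]
          push_cast
          rw [add_neg_cancel, zero_smul]
        · simp [hw, hj]
      rw [sub_sub, hdiag, sub_zero]
      refine norm_sum_le_of_le _ fun m hm => ?_
      by_cases hjm : (j : ℤ) = l + m
      · rw [if_pos hjm]
        split_ifs
        · have : w (j - m) = v := by simp [hw, hjm]
          rw [this]
          exact (H m).le_of_opNorm_le (hα m (abs_le.2 (Finset.mem_Icc.1 hm))) _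
        · rw [norm_zero]; positivity
      · have : w (j - m) = 0 := by
          simp only [hw]
          rw [if_neg (by omega)]
        rw [if_neg hjm, this]
        simp
    refine (norm_le_sum_norm _).trans ((Finset.sum_le_sum fun j _ => hcomp j).trans ?_)
    rw [Finset.sum_comm]
    have : ∀ m ∈ Finset.Icc (-(M : ℤ)) M,
        (∑ j : indices L, if (j : ℤ) = l + m then α * ‖v‖ else 0) ≤ α * ‖truncate L w‖ := by
      intro m _
      rw [Finset.sum_coe_sort (indices L) (fun j => if j = l + m then α * ‖v‖ else 0),
        Finset.sum_ite_eq']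
      have := mul_le_mul_of_nonneg_left hwl hα0
      split_ifs
      · exact this
      · positivity
    refine (Finset.sum_le_sum this).trans (le_of_eq ?_)
    rw [Finset.sum_const, nsmul_eq_mul, card_Icc_neg_self]
    ring
  obtain ⟨x, hx, hle⟩ := exists_real_hasEigenvalue_near (isSymmetric_truncHamiltonian hT hH L)
    (norm_pos_iff.1 (hvpos.trans_le hwl)) hres
  exact ⟨x, hx, by rwa [sub_neg_eq_add] at hle⟩

/-- Moving the decay radius by at most `(2M + 1) / 2` costs at most a factor `2`. -/
theorem exp_half_div_le (M : ℕ) {s : ℝ} (hs : s ≤ (2 * M + 1) / 2) :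
    Real.exp (s / (2 * M + 1)) ≤ 2 := by
  have h1 : Real.exp (s / (2 * M + 1)) ≤ Real.exp (1 / 2) := by
    refine Real.exp_le_exp.2 ?_
    rw [div_le_iff₀ (by positivity)]
    linarith
  have h2 : Real.exp (1 / 2) ^ 2 = Real.exp 1 := by
    rw [← Real.exp_nat_mul]; norm_num
  have h3 := Real.exp_one_lt_d9
  nlinarith [Real.exp_pos (1 / 2)]

theorem sinh_mul_div_freq (α T : ℝ) :
    Real.sinh 1 * (α / freq T) = Real.sinh 1 / (2 * Real.pi) * (α * T) := by
  rw [freq, div_div_eq_mul_div]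
  ring

/-- The truncation of a shifted Floquet eigenvector is an approximate eigenvector of `H_F^L`, as
long as the exponential `X` in the error bound is small. -/
theorem exists_truncEigenvalue_near_of_small [FiniteDimensional ℂ E] (hT : 0 < T)
    (hH : ∀ t : ℝ, (hamiltonian M T H t : E →ₗ[ℂ] E).IsSymmetric)
    (hα : ∀ m : ℤ, |m| ≤ (M : ℤ) → ‖H m‖ ≤ α) {ε : ℝ} (hε : ε ∈ brillouinZone T) {a : ℤ → E}
    (hs : Summable fun k => ‖a k‖ ^ 2) (hne : ∃ k, a k ≠ 0)
    (h : ∀ k, ∑ m ∈ Finset.Icc (-(M : ℤ)) M, H m (a (k - m)) =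
        (((k : ℝ) * freq T + ε : ℝ) : ℂ) • a k) {l : ℤ} {X : ℝ}
    (hX : X = Real.exp (-(((L : ℝ) - |(l : ℝ)|) / (2 * (M : ℝ) + 1))
                + Real.sinh 1 / (2 * Real.pi) * (α * T))) (hXs : X ≤ 1 / 4) :
    ∃ x : ℝ, IsTruncEigenvalue M T H L x ∧
      |x - (ε - l * freq T)| ≤ 4 * (2 * M + 1) ^ 2 * α * X := by
  have hω := freq_pos hT
  have hα0 := nonneg_of_norm_le hα
  have hXpos : 0 < X := hX ▸ Real.exp_pos _
  set n : ℝ := 2 * M + 1 with hn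
  have hnpos : 0 < n := by positivity
  set S : ℝ := ∑' k, ‖a k‖ ^ 2 with hS
  have hSpos : 0 < S := by
    obtain ⟨k, hk⟩ := hne
    exact hs.tsum_pos (fun k => sq_nonneg _) k (by have := norm_pos_iff.2 hk; positivity)
  set R : ℝ := L - |(l : ℝ)| - 1 / 2 with hR
  set Y : ℝ := Real.exp (Real.sinh 1 * (α / freq T) - R / n) with hY
  have hYX : Y ≤ 2 * X := by
    have hYeq : Y = Real.exp (1 / 2 / n) * X := by
      rw [hY, hX, sinh_mul_div_freq, ← Real.exp_add, hR]
      congr 1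
      ring
    rw [hYeq]
    exact mul_le_mul_of_nonneg_right
      (exp_half_div_le M (by linarith [(Nat.cast_nonneg M : (0 : ℝ) ≤ M)])) hXpos.le
  have hYpos : 0 < Y := Real.exp_pos _
  have hout : ∀ k : ℤ, k + l ∉ indices L → R ≤ |(k : ℝ) + ε / freq T| := by
    intro k hk
    have hθ : |ε / freq T| ≤ 1 / 2 := by
      rw [abs_le]
      constructor
      · rw [le_div_iff₀ hω]; linarith [hε.1]
      · rw [div_le_iff₀ hω]; linarith [hε.2]
    have hkl : (L : ℝ) - |(l : ℝ)| ≤ |(k : ℝ)| := by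
      have : (L : ℤ) - |l| ≤ |k| := by
        simp only [indices, Finset.mem_Icc] at hk
        have := le_abs_self l
        have := neg_le_abs l
        have := le_abs_self k
        have := neg_le_abs k
        omega
      exact_mod_cast this
    have h1 : |(k : ℝ)| ≤ |(k : ℝ) + ε / freq T| + |ε / freq T| := by
      have := abs_sub ((k : ℝ) + ε / freq T) (ε / freq T)
      rwa [add_sub_cancel_right] at this
    linarith
  have hdec := fun k => decay_hypothesis hT hα (h k)
  have hpt : ∀ k : ℤ, k + l ∉ indices L → ‖a k‖ ≤ Y * √S := fun k hk =>
    le_exp_of_le_abs hω hα0 (fun k => norm_nonneg (a k)) hs hdec (hout k hk)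
  set w : ℤ → E := fun j => a (j - l) with hw
  have hnorm : √S / 2 ≤ ‖truncate L w‖ := by
    refine abs_le_of_sq_le_sq' ?_ (norm_nonneg _) |>.2
    rw [norm_truncate_sq, div_pow, Real.sq_sqrt hSpos.le]
    have hF : ∑ j ∈ indices L, ‖w j‖ ^ 2 =
        ∑ k ∈ Finset.Icc (-(L : ℤ) + 1 - l) (L - l), ‖a k‖ ^ 2 := by
      refine Finset.sum_nbij' (fun j => j - l) (fun k => k + l) ?_ ?_ ?_ ?_ ?_
      · intro j; simp only [indices, Finset.mem_Icc]; omega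
      · intro k; simp only [indices, Finset.mem_Icc]; omega
      · simp
      · simp
      · simp [hw]
    have hsplit := hs.sum_add_tsum_compl (s := Finset.Icc (-(L : ℤ) + 1 - l) (L - l))
    have htail := sum_compl_le hω hα0 (fun k => norm_nonneg (a k)) hs hdec R
      ((Finset.Icc (-(L : ℤ) + 1 - l) (L - l) : Finset ℤ) : Set ℤ)ᶜ (fun k hk => by
        refine hout k ?_
        rw [Set.mem_compl_iff, Finset.mem_coe, Finset.mem_Icc] at hk
        simp only [indices, Finset.mem_Icc]
        omega)
    rw [← hn, two_mul, Real.exp_add, ← hY, ← hS] at htail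
    have hYY : Y * Y ≤ 1 / 4 := by nlinarith
    have := mul_le_mul_of_nonneg_right hYY hSpos.le
    rw [hF]
    rw [← hS] at hsplit
    norm_num
    linarith
  have hupos : 0 < ‖truncate L w‖ := by
    have := Real.sqrt_pos.2 hSpos
    linarith
  have hres : ‖truncHamiltonian M T H L (truncate L w) -
      ((ε - l * freq T : ℝ) : ℂ) • truncate L w‖ ≤ 4 * n ^ 2 * α * X * ‖truncate L w‖ := by
    -- only the terms of the full eigenvalue equation that leave `[L]` survive
    have hcomp : ∀ j : indices L, ‖(truncHamiltonian M T H L (truncate L w) -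
        ((ε - l * freq T : ℝ) : ℂ) • truncate L w) j‖ ≤
        ∑ m ∈ Finset.Icc (-(M : ℤ)) M,
          if (j : ℤ) + -m ∈ indices L then 0 else α * (Y * √S) := by
      intro j
      rw [PiLp.sub_apply, PiLp.smul_apply, truncHamiltonian_truncate]
      have hfull : (((j : ℤ) : ℂ) * (freq T : ℂ)) • w j +
          ((ε - l * freq T : ℝ) : ℂ) • truncate L w j =
          ∑ m ∈ Finset.Icc (-(M : ℤ)) M, H m (w (j - m)) := by
        change _ + ((ε - l * freq T : ℝ) : ℂ) • w j = _
        have := h (j - l)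
        simp only [hw]
        rw [← add_smul]
        simp_rw [sub_right_comm (j : ℤ) _ l]
        rw [this]
        congr 1
        push_cast
        ring
      rw [sub_sub, hfull, ← Finset.sum_sub_distrib]
      refine norm_sum_le_of_le _ fun m hm => ?_
      rw [← sub_eq_add_neg]
      split_ifs with hjm
      · simp
      · rw [zero_sub, norm_neg]
        refine (H m).le_of_opNorm_le_of_le (hα m (abs_le.2 (Finset.mem_Icc.1 hm))) (hpt _ ?_)
        simpa using hjm
    refine (norm_le_sum_norm _).trans ((Finset.sum_le_sum fun j _ => hcomp j).trans ?_)
    rw [Finset.sum_comm]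
    have hB : 0 ≤ α * (Y * √S) := by positivity
    have : ∀ m ∈ Finset.Icc (-(M : ℤ)) M,
        (∑ j : indices L, if (j : ℤ) + -m ∈ indices L then 0 else α * (Y * √S)) ≤
          M * (α * (Y * √S)) := by
      intro m hm
      rw [Finset.sum_coe_sort (indices L)
        (fun j => if j + -m ∈ indices L then 0 else α * (Y * √S))]
      refine sum_shift_out_le ?_ hB
      rw [Finset.mem_Icc] at hm ⊢
      omega
    refine (Finset.sum_le_sum this).trans ?_
    rw [Finset.sum_const, nsmul_eq_mul, card_Icc_neg_self, ← hn]
    have hMn : (M : ℝ) ≤ n := by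
      rw [hn]; linarith [(Nat.cast_nonneg M : (0 : ℝ) ≤ M)]
    have h1 : Y * √S ≤ 2 * X * (2 * ‖truncate L w‖) :=
      mul_le_mul hYX (by linarith) (Real.sqrt_nonneg _) (by positivity)
    calc n * (M * (α * (Y * √S))) ≤ n * (n * (α * (2 * X * (2 * ‖truncate L w‖)))) := by gcongr
      _ = _ := by ring
  exact exists_real_hasEigenvalue_near (isSymmetric_truncHamiltonian hT hH L)
    (norm_pos_iff.1 hupos) hres

/-- Quasienergies and their shifts are approximated by eigenvalues of `H_F^L`. -/
theorem exists_truncEigenvalue_near_quasienergy [FiniteDimensional ℂ E] (hT : 0 < T)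
    (hH : ∀ t : ℝ, (hamiltonian M T H t : E →ₗ[ℂ] E).IsSymmetric)
    (hα : ∀ m : ℤ, |m| ≤ (M : ℤ) → ‖H m‖ ≤ α) {ε : ℝ} (hε : ε ∈ brillouinZone T)
    (hq : IsQuasienergy M T H ε) {l : ℤ} (hl : l ∈ indices L) :
    ∃ x : ℝ, IsTruncEigenvalue M T H L x ∧
      |x - (ε - (l : ℝ) * freq T)| / freq T ≤
        8 * (2 * (M : ℝ) + 1) ^ 2 * (α * T) *
          Real.exp (-(((L : ℝ) - |(l : ℝ)|) / (2 * (M : ℝ) + 1))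
            + Real.sinh 1 / (2 * Real.pi) * (α * T)) := by
  obtain ⟨a, hs, hne, h⟩ := exists_floquet_eigenvector hT hq
  have hω := freq_pos hT
  have hα0 := nonneg_of_norm_le hα
  set X := Real.exp (-(((L : ℝ) - |(l : ℝ)|) / (2 * (M : ℝ) + 1))
    + Real.sinh 1 / (2 * Real.pi) * (α * T)) with hX
  have hXpos : 0 < X := Real.exp_pos _
  have hMn : (1 : ℝ) ≤ 2 * M + 1 := by linarith [(Nat.cast_nonneg M : (0 : ℝ) ≤ M)]
  have hTω : 1 ≤ T * freq T := by
    rw [mul_comm, freq_mul_period hT]; linarith [Real.pi_gt_three]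
  rcases le_or_gt X (1 / 4) with hXs | hXs
  · obtain ⟨x, hx, hle⟩ := exists_truncEigenvalue_near_of_small hT hH hα hε hs hne h hX hXs
    refine ⟨x, hx, ?_⟩
    rw [div_le_iff₀ hω]
    refine hle.trans ?_
    have h1 : 0 ≤ 4 * (2 * (M : ℝ) + 1) ^ 2 * α * X := by positivity
    have h2 := mul_le_mul_of_nonneg_left hTω h1
    nlinarith
  · have : Nontrivial E := let ⟨k, hk⟩ := hne; ⟨a k, 0, hk⟩
    obtain ⟨x, hx, hle⟩ := exists_truncEigenvalue_near_diagonal hT hH hα hl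
    have hε' := abs_le_of_floquet_eigenvector hT hα hε hs hne h
    refine ⟨x, hx, ?_⟩
    rw [div_le_iff₀ hω]
    -- here `X > 1 / 4`, and the trivial bound on both sides of the spectrum is good enough
    have h0 : |x - (ε - (l : ℝ) * freq T)| ≤ |x + l * freq T| + |ε| := by
      have := abs_sub (x + l * freq T) ε
      rwa [show x + l * freq T - ε = x - (ε - (l : ℝ) * freq T) by ring] at this
    have h1 : 0 ≤ (2 * (M : ℝ) + 1) * α := by positivity
    have h2 : (2 * (M : ℝ) + 1) * α ≤ (2 * (M : ℝ) + 1) ^ 2 * α * (T * freq T) := by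
      calc (2 * (M : ℝ) + 1) * α = (2 * (M : ℝ) + 1) * α * 1 * 1 := by ring
        _ ≤ (2 * (M : ℝ) + 1) * α * (2 * (M : ℝ) + 1) * (T * freq T) := by gcongr
        _ = _ := by ring
    have h3 : 0 ≤ 8 * ((2 * (M : ℝ) + 1) ^ 2 * α * (T * freq T)) := by
      have : 0 ≤ T * freq T := by linarith
      positivity
    have h4 := mul_le_mul_of_nonneg_left hXs.le h3
    linarith

end truncation

/-! ### From eigenvalues of the truncation to quasienergies -/

section unitary

variable {E : Type*} [NormedAddCommGroup E] [InnerProductSpace ℂ E]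

/-- The product rule for `V s (g s)` in a real variable `s`, with `V s` complex-linear. -/
theorem hasDerivAt_clm_apply {V : ℝ → E →L[ℂ] E} {V' : E →L[ℂ] E} {g : ℝ → E} {g' : E} {t : ℝ}
    (hV : HasDerivAt V V' t) (hg : HasDerivAt g g' t) :
    HasDerivAt (fun s => V s (g s)) (V' (g t) + V t g') t := by
  have hV' : HasDerivAt (fun s => (V s).restrictScalars ℝ) (V'.restrictScalars ℝ) t :=
    (ContinuousLinearMap.restrictScalarsL ℂ E E ℝ ℝ).hasFDerivAt.comp_hasDerivAt t hV
  exact hV'.clm_apply hg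

theorem norm_apply_of_star_mul_self [CompleteSpace E] {U : E →L[ℂ] E} (h : star U * U = 1) (y : E) :
    ‖U y‖ = ‖y‖ :=
  (ContinuousLinearMap.norm_map_iff_adjoint_comp_self U).2 h y

end unitary

section modOne

theorem four_mul_abs_modOne_le {T : ℝ} (hT : 0 < T) (ε x : ℝ) :
    4 * |modOne ((ε - x) / freq T)| ≤
      ‖Complex.exp (-Complex.I * (ε : ℂ) * (T : ℂ)) - Complex.exp (-Complex.I * (x : ℂ) * (T : ℂ))‖
      := by
  set d : ℝ := (ε - x) / freq T with hd
  set y : ℝ := modOne d with hy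
  have hmem : y ∈ Set.Ico (-(1 / 2)) (-(1 / 2) + (1 : ℝ)) := toIcoMod_mem_Ico _ _ _
  obtain ⟨n, hn⟩ : ∃ n : ℤ, d = y + n := by
    refine ⟨toIcoDiv (zero_lt_one : (0 : ℝ) < 1) (-(1 / 2)) d, ?_⟩
    have := toIcoMod_add_toIcoDiv_zsmul (zero_lt_one : (0 : ℝ) < 1) (-(1 / 2)) d
    rw [zsmul_eq_mul, mul_one] at this
    exact this.symm
  have hxT : (ε - x) * T = 2 * Real.pi * (y + n) := by
    rw [← hn, hd, freq]
    have := Real.pi_pos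
    field_simp
  have hexp : Complex.exp (-Complex.I * (x : ℂ) * (T : ℂ)) =
      Complex.exp (-Complex.I * (ε : ℂ) * (T : ℂ)) *
        Complex.exp (Complex.I * ((2 * Real.pi * y : ℝ) : ℂ)) := by
    rw [← Complex.exp_add, Complex.exp_eq_exp_iff_exists_int]
    refine ⟨n, ?_⟩
    have hc := congrArg (fun r : ℝ => (r : ℂ)) hxT
    push_cast at hc ⊢
    linear_combination Complex.I * hc
  have hnorm : ‖Complex.exp (-Complex.I * (ε : ℂ) * (T : ℂ))‖ = 1 := by
    rw [Complex.norm_exp]; simp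
  rw [hexp, ← norm_neg, neg_sub,
    show ∀ p q : ℂ, p * q - p = p * (q - 1) from fun p q => by ring, norm_mul, hnorm, one_mul,
    Complex.norm_exp_I_mul_ofReal_sub_one, norm_mul, Real.norm_ofNat, Real.norm_eq_abs]
  have habs : |y| ≤ 1 / 2 := abs_le.2 ⟨hmem.1, by linarith [hmem.2]⟩
  have hpi := Real.pi_pos
  have h1 : |2 * Real.pi * y / 2| = Real.pi * |y| := by
    rw [show 2 * Real.pi * y / 2 = Real.pi * y by ring, abs_mul, abs_of_pos hpi]
  have h2 := Real.mul_abs_le_abs_sin (x := 2 * Real.pi * y / 2) (by rw [h1]; nlinarith)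
  rw [h1] at h2
  have h3 : 2 / Real.pi * (Real.pi * |y|) = 2 * |y| := by field_simp
  linarith

/-- Every complex number of modulus one is `e^{-iεT}` for some `ε` in the Brillouin zone. -/
theorem exists_mem_brillouinZone {T : ℝ} (hT : 0 < T) {ν : ℂ} (hν : ‖ν‖ = 1) :
    ∃ ε ∈ brillouinZone T, Complex.exp (-Complex.I * (ε : ℂ) * (T : ℂ)) = ν := by
  have hhalf : freq T / 2 = Real.pi / T := by rw [freq]; ring
  -- the half-open ends match: `arg` takes values in `(-π, π]`
  refine ⟨-Complex.arg ν / T, ⟨?_, ?_⟩, ?_⟩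
  · rw [hhalf, ← neg_div]
    exact div_le_div_of_nonneg_right (neg_le_neg (Complex.arg_le_pi ν)) hT.le
  · rw [hhalf]
    exact div_lt_div_of_pos_right (by linarith [Complex.neg_pi_lt_arg ν]) hT
  · have h := Complex.norm_mul_exp_arg_mul_I ν
    rw [hν, Complex.ofReal_one, one_mul] at h
    conv_rhs => rw [← h]
    congr 1
    have hTc : (T : ℂ) ≠ 0 := by exact_mod_cast hT.ne'
    push_cast
    field_simp

end modOne

section converse

variable {E : Type*} [NormedAddCommGroup E] [InnerProductSpace ℂ E]
  {M : ℕ} {T α : ℝ} {H : ℤ → E →L[ℂ] E} {L : ℕ}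

/-- The trigonometric polynomial `∑_{l ∈ [L]} e^{-ilωt} u_l`. -/
noncomputable def trigPoly (T : ℝ) (L : ℕ) (u : ℤ → E) (t : ℝ) : E :=
  ∑ l ∈ indices L, phase T l t • u l

theorem trigPoly_add_period (hT : 0 < T) (u : ℤ → E) (t : ℝ) :
    trigPoly T L u (t + T) = trigPoly T L u t := by
  simp only [trigPoly, phase_add_period hT]

theorem hasDerivAt_trigPoly (u : ℤ → E) (t : ℝ) :
    HasDerivAt (trigPoly T L u)
      (-Complex.I • trigPoly T L (fun l => ((l : ℂ) * (freq T : ℂ)) • u l) t) t := by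
  have h := HasDerivAt.fun_sum (u := indices L) fun l _ =>
    (hasDerivAt_phase (T := T) l t).smul_const (u l)
  refine h.congr_deriv ?_
  rw [trigPoly, Finset.smul_sum]
  refine Finset.sum_congr rfl fun l _ => ?_
  module

/-- Parseval for trigonometric polynomials, in the form that some value is at least the root mean
square. -/
theorem exists_le_norm_trigPoly (hT : 0 < T) (u : ℤ → E) :
    ∃ t : ℝ, ∑ l ∈ indices L, ‖u l‖ ^ 2 ≤ ‖trigPoly T L u t‖ ^ 2 := by
  have hcont : Continuous (trigPoly T L u) := by unfold trigPoly; fun_prop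
  obtain ⟨t₀, -, hmax⟩ := isCompact_Icc.exists_isMaxOn (s := Set.Icc 0 T) ⟨0, le_rfl, hT.le⟩
    (hcont.norm.pow 2).continuousOn
  refine ⟨t₀, ?_⟩
  have hint : ∫ t in (0 : ℝ)..T, ‖trigPoly T L u t‖ ^ 2 = T * ∑ l ∈ indices L, ‖u l‖ ^ 2 := by
    have hpt : ∀ t, ((‖trigPoly T L u t‖ ^ 2 : ℝ) : ℂ) = ∑ k ∈ indices L,
        phase T (-k) t * ∑ l ∈ indices L, phase T l t * inner ℂ (u k) (u l) := by
      intro t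
      rw [Complex.ofReal_pow]
      refine (inner_self_eq_norm_sq_to_K (𝕜 := ℂ) (trigPoly T L u t)).symm.trans ?_
      rw [trigPoly, sum_inner]
      refine Finset.sum_congr rfl fun k _ => ?_
      rw [inner_smul_left, conj_phase, inner_sum]
      simp_rw [inner_smul_right]
    have hc : ((∫ t in (0 : ℝ)..T, ‖trigPoly T L u t‖ ^ 2 : ℝ) : ℂ) =
        ((T * ∑ l ∈ indices L, ‖u l‖ ^ 2 : ℝ) : ℂ) := by
      rw [← intervalIntegral.integral_ofReal]
      simp_rw [hpt]
      rw [intervalIntegral.integral_finsetSum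
        fun m _ => (by fun_prop : Continuous _).intervalIntegrable _ _]
      simp_rw [integral_phase_mul_sum hT]
      rw [Complex.ofReal_mul, Complex.ofReal_sum, Finset.mul_sum]
      refine Finset.sum_congr rfl fun k hk => ?_
      rw [if_pos hk, inner_self_eq_norm_sq_to_K]
      simp
    exact_mod_cast hc
  have hle : ∫ t in (0 : ℝ)..T, ‖trigPoly T L u t‖ ^ 2 ≤
      ∫ _ in (0 : ℝ)..T, ‖trigPoly T L u t₀‖ ^ 2 :=
    intervalIntegral.integral_mono_on hT.le ((hcont.norm.pow 2).intervalIntegrable _ _)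
      intervalIntegrable_const fun t ht => hmax ht
  rw [hint, intervalIntegral.integral_const, sub_zero, smul_eq_mul] at hle
  exact le_of_mul_le_mul_left hle hT

/-- Extended by zero, an eigenvector of `H_F^L` fails to be an eigenvector of the untruncated
Floquet Hamiltonian only through the components near the boundary of `[L]`. -/
theorem norm_residual_le (hα : ∀ m : ℤ, |m| ≤ (M : ℤ) → ‖H m‖ ≤ α) {x B : ℝ} {u : ℤ → E}
    (hB : 0 ≤ B)
    (heig : ∀ j ∈ indices L, ∑ m ∈ Finset.Icc (-(M : ℤ)) M,
      (if j - m ∈ indices L then H m (u (j - m)) else 0) =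
        (((j : ℝ) * freq T + x : ℝ) : ℂ) • u j)
    (hedge : ∀ l ∈ indices L, ∀ m ∈ Finset.Icc (-(M : ℤ)) M, l + m ∉ indices L → ‖u l‖ ≤ B)
    (t : ℝ) :
    ‖hamiltonian M T H t (trigPoly T L u t) -
      trigPoly T L (fun l => ((l : ℂ) * (freq T : ℂ)) • u l) t - (x : ℂ) • trigPoly T L u t‖ ≤
        (2 * M + 1) * (M * (α * B)) := by
  have hα0 := nonneg_of_norm_le hα
  have h1 : hamiltonian M T H t (trigPoly T L u t) = ∑ m ∈ Finset.Icc (-(M : ℤ)) M,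
      ∑ l ∈ indices L, phase T (l + m) t • H m (u l) := by
    rw [hamiltonian, sum_apply]
    refine Finset.sum_congr rfl fun m _ => ?_
    rw [smul_apply, trigPoly, map_sum, Finset.smul_sum]
    refine Finset.sum_congr rfl fun l _ => ?_
    rw [map_smul, smul_smul, add_comm l, ← phase_mul]
    rfl
  have h2 : trigPoly T L (fun l => ((l : ℂ) * (freq T : ℂ)) • u l) t + (x : ℂ) • trigPoly T L u t =
      ∑ m ∈ Finset.Icc (-(M : ℤ)) M, ∑ l ∈ indices L,
        if l + m ∈ indices L then phase T (l + m) t • H m (u l) else 0 := by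
    have h3 : ∀ m, (∑ l ∈ indices L,
        if l + m ∈ indices L then phase T (l + m) t • H m (u l) else 0) =
        ∑ j ∈ indices L, phase T j t • if j - m ∈ indices L then H m (u (j - m)) else 0 := by
      intro m
      simp_rw [smul_ite, smul_zero]
      rw [← Finset.sum_filter, ← Finset.sum_filter]
      refine Finset.sum_nbij' (fun l => l + m) (fun j => j - m) ?_ ?_ ?_ ?_ ?_
      · intro l
        simp only [Finset.mem_filter, add_sub_cancel_right]
        tauto
      · intro j
        simp only [Finset.mem_filter, sub_add_cancel]
        tauto
      · simp
      · simp
      · simp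
    simp_rw [h3]
    rw [Finset.sum_comm, trigPoly, trigPoly, Finset.smul_sum, ← Finset.sum_add_distrib]
    refine Finset.sum_congr rfl fun j hj => ?_
    rw [← Finset.smul_sum, heig j hj]
    push_cast
    module
  rw [sub_sub, h2, h1, ← Finset.sum_sub_distrib]
  have h4 : ∀ m ∈ Finset.Icc (-(M : ℤ)) M, ‖∑ l ∈ indices L, phase T (l + m) t • H m (u l) -
      ∑ l ∈ indices L, (if l + m ∈ indices L then phase T (l + m) t • H m (u l) else 0)‖ ≤
      M * (α * B) := by
    intro m hm
    rw [← Finset.sum_sub_distrib]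
    refine (norm_sum_le_of_le _ fun l hl => ?_).trans
      (sum_shift_out_le (L := L) hm (B := α * B) (by positivity))
    split_ifs with hlm
    · simp
    · rw [sub_zero, norm_smul, norm_phase_eq_one, one_mul]
      exact (H m).le_of_opNorm_le_of_le (hα m (abs_le.2 (Finset.mem_Icc.1 hm)))
        (hedge l hl m hm hlm)
  refine (norm_sum_le_of_le _ h4).trans (le_of_eq ?_)
  rw [Finset.sum_const, nsmul_eq_mul, card_Icc_neg_self]

/-- A periodic approximate solution of the Floquet eigenvalue equation is close to a quasienergy:
transporting it back by the propagator over one period gives an approximate eigenvector of the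
unitary monodromy operator. -/
theorem exists_quasienergy_near_of_residual [FiniteDimensional ℂ E] (hT : 0 < T)
    (hH : ∀ t : ℝ, (hamiltonian M T H t : E →ₗ[ℂ] E).IsSymmetric) {x ρ : ℝ} {v v' : ℝ → E}
    (hv : ∀ t, HasDerivAt v (-Complex.I • v' t) t) (hper : Function.Periodic v T)
    (hρ : ∀ t, ‖hamiltonian M T H t (v t) - v' t - (x : ℂ) • v t‖ ≤ ρ) {η t₀ : ℝ}
    (hv0 : v t₀ ≠ 0) (hη : ρ * T ≤ η * ‖v t₀‖) :
    ∃ ε ∈ brillouinZone T, IsQuasienergy M T H ε ∧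
      4 * |modOne ((ε - x) / freq T)| ≤ η := by
  have : CompleteSpace E := FiniteDimensional.complete ℂ E
  obtain ⟨U, hU, hunit, hmono⟩ := exists_propagator hT hH
  have hstar : ∀ t, star (hamiltonian M T H t) = hamiltonian M T H t := fun t =>
    (ContinuousLinearMap.isSelfAdjoint_iff_isSymmetric.2 (hH t)).star_eq
  have hunit' : ∀ t, U t * star (U t) = 1 := fun t => mul_star_self_of_star_mul_self (hunit t)
  have hnormU : ∀ t y, ‖U t y‖ = ‖y‖ := fun t => norm_apply_of_star_mul_self (hunit t)
  have hnormS : ∀ t y, ‖star (U t) y‖ = ‖y‖ := fun t =>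
    norm_apply_of_star_mul_self (by rw [star_star]; exact hunit' t)
  set e : ℝ → ℂ := fun t => Complex.exp (-Complex.I * (x : ℂ) * (t : ℂ)) with he
  have hed : ∀ t, HasDerivAt e (-Complex.I * x * e t) t := hasDerivAt_cexp_mul_ofReal _
  have henorm : ∀ t, ‖e t‖ = 1 := fun t => by
    simp only [he]
    rw [Complex.norm_exp]
    simp
  have heT : ∀ t, e (t + T) = e T * e t := fun t => by
    simp only [he]
    rw [← Complex.exp_add]
    congr 1
    push_cast
    ring
  -- the interaction picture: `f` varies only through the residual
  set f : ℝ → E := fun t => star (U t) (e t • v t) with hf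
  have hfd : ∀ t, HasDerivAt f (star (U t) ((Complex.I * e t) •
      (hamiltonian M T H t (v t) - v' t - (x : ℂ) • v t))) t := by
    intro t
    have h1 := (hU t).star
    have h2 := (hed t).smul (hv t)
    have h3 : HasDerivAt f (star (-Complex.I • hamiltonian M T H t * U t) (e t • v t) +
        star (U t) (e t • -Complex.I • v' t + (-Complex.I * x * e t) • v t)) t := by
      exact hasDerivAt_clm_apply h1 h2
    refine h3.congr_deriv ?_
    rw [star_mul, star_smul, hstar]
    simp only [mul_apply_eq_comp, smul_apply, ← map_add]
    congr 1
    simp only [map_smul, RCLike.star_def, map_neg, Complex.conj_I, neg_neg]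
    module
  have hfdiff : ‖f (t₀ + T) - f t₀‖ ≤ ρ * T := by
    have h := Convex.norm_image_sub_le_of_norm_hasDerivWithin_le (f := f) (s := Set.univ) (C := ρ)
      (fun t _ => (hfd t).hasDerivWithinAt) (fun t _ => by
        rw [hnormS, norm_smul, norm_mul, Complex.norm_I, henorm, one_mul, one_mul]
        exact hρ t) convex_univ (Set.mem_univ t₀) (Set.mem_univ (t₀ + T))
    rwa [add_sub_cancel_left, Real.norm_of_nonneg hT.le] at h
  set z := f t₀ with hz
  have hznorm : ‖z‖ = ‖v t₀‖ := by
    rw [hz, hf, hnormS, norm_smul, henorm, one_mul]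
  have hz0 : z ≠ 0 := norm_pos_iff.1 (hznorm ▸ norm_pos_iff.2 hv0)
  have hWf : U T (f (t₀ + T)) = e T • z := by
    simp only [hz, hf]
    rw [hmono, star_mul, mul_apply_eq_comp, ← mul_apply_eq_comp (U T),
      hunit', one_apply_eq_self, hper, heT, mul_smul, map_smul]
  have happrox : ‖(U T).toLinearMap z - e T • z‖ ≤ η * ‖z‖ := by
    rw [hznorm]
    refine le_trans ?_ hη
    rw [← hWf, ContinuousLinearMap.coe_coe, ← map_sub, hnormU, norm_sub_rev]
    exact hfdiff
  have hcomm : Commute (LinearMap.adjoint (U T).toLinearMap) (U T).toLinearMap := by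
    have hadj : LinearMap.adjoint (U T).toLinearMap = (star (U T)).toLinearMap := by
      refine ((LinearMap.eq_adjoint_iff _ _).2 fun y w => ?_).symm
      exact ContinuousLinearMap.adjoint_inner_left (U T) w y
    rw [hadj]
    refine LinearMap.ext fun y => ?_
    exact congrArg (fun F : E →L[ℂ] E => F y) ((hunit T).trans (hunit' T).symm)
  obtain ⟨ν, hν, hνle⟩ := exists_hasEigenvalue_near hcomm hz0 happrox
  obtain ⟨y, hy⟩ := hν.exists_hasEigenvector
  have hWy : U T y = ν • y := hy.apply_eq_smul
  have hypos : 0 < ‖y‖ := norm_pos_iff.2 hy.2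
  have hνnorm : ‖ν‖ = 1 := by
    have := hnormU T y
    rw [hWy, norm_smul] at this
    exact mul_right_cancel₀ hypos.ne' (this.trans (one_mul _).symm)
  obtain ⟨ε, hε, hεν⟩ := exists_mem_brillouinZone hT hνnorm
  refine ⟨ε, hε, ?_, ?_⟩
  · have hinv : ∀ t : ℝ, Complex.exp (-Complex.I * (ε : ℂ) * (t : ℂ)) *
        Complex.exp (Complex.I * (ε : ℂ) * (t : ℂ)) = 1 := by
      intro s
      rw [← Complex.exp_add]
      simp
    have hψ : ∀ s : ℝ, Complex.exp (-Complex.I * (ε : ℂ) * (s : ℂ)) •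
        Complex.exp (Complex.I * (ε : ℂ) * (s : ℂ)) • U s y = U s y := by
      intro s
      rw [smul_smul, hinv, one_smul]
    refine ⟨fun t => Complex.exp (Complex.I * (ε : ℂ) * (t : ℂ)) • U t y, ?_, ?_, ?_⟩
    · intro h0
      have h1 := congrFun h0 0
      simp only [Complex.ofReal_zero, mul_zero, Complex.exp_zero, one_smul, Pi.zero_apply] at h1
      have := hnormU 0 y
      rw [h1, norm_zero] at this
      linarith
    · intro t
      simp only
      rw [hmono, mul_apply_eq_comp, hWy, map_smul, smul_smul, ← hεν,
        ← Complex.exp_add]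
      congr 2
      push_cast
      ring
    · intro t
      simp only [hψ]
      refine (hasDerivAt_clm_apply (hU t) (hasDerivAt_const t y)).congr_deriv ?_
      simp
  · refine (four_mul_abs_modOne_le hT ε x).trans ?_
    rw [hεν]
    exact hνle

/-- Eigenvalues of `H_F^L` are approximated by quasienergies. -/
theorem exists_quasienergy_near_truncEigenvalue [FiniteDimensional ℂ E] (hT : 0 < T)
    (hH : ∀ t : ℝ, (hamiltonian M T H t : E →ₗ[ℂ] E).IsSymmetric)
    (hα : ∀ m : ℤ, |m| ≤ (M : ℤ) → ‖H m‖ ≤ α) {x : ℝ} (hx : IsTruncEigenvalue M T H L x) :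
    ∃ ε ∈ brillouinZone T, IsQuasienergy M T H ε ∧
      |modOne ((ε - x) / freq T)| ≤
        9 * (2 * (M : ℝ) + 1) ^ 2 * (α * T) *
          Real.exp (-(((L : ℝ) - |x| / freq T) / (2 * (M : ℝ) + 1))
            + Real.sinh 1 / (2 * Real.pi) * (α * T)) := by
  have hω := freq_pos hT
  have hα0 := nonneg_of_norm_le hα
  set n : ℝ := 2 * M + 1 with hn
  have hM0 : (0 : ℝ) ≤ M := Nat.cast_nonneg M
  have hnpos : 0 < n := by positivity
  set X : ℝ := Real.exp (-(((L : ℝ) - |x| / freq T) / n)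
    + Real.sinh 1 / (2 * Real.pi) * (α * T)) with hX
  have hXpos : 0 < X := Real.exp_pos _
  obtain ⟨ψ, hψ⟩ := Module.End.HasEigenvalue.exists_hasEigenvector hx
  set u : ℤ → E := fun k => if hk : k ∈ indices L then ψ ⟨k, hk⟩ else 0 with hu
  have huψ : truncate L u = ψ := by
    ext j
    change u j = ψ j
    simp only [hu]
    rw [dif_pos j.2]
  have huout : ∀ k ∉ indices L, u k = 0 := fun k hk => dif_neg hk
  have heig : ∀ j ∈ indices L, ∑ m ∈ Finset.Icc (-(M : ℤ)) M,
      (if j - m ∈ indices L then H m (u (j - m)) else 0) =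
        (((j : ℝ) * freq T + x : ℝ) : ℂ) • u j := by
    intro j hj
    have h1 : truncHamiltonian M T H L (truncate L u) ⟨j, hj⟩ = (x : ℂ) • u j := by
      rw [huψ, hψ.apply_eq_smul, ← huψ]
      rfl
    rw [truncHamiltonian_truncate, sub_eq_iff_eq_add] at h1
    refine h1.trans ?_
    rw [← add_smul]
    push_cast
    congr 1
    ring
  have hs : Summable fun k => ‖u k‖ ^ 2 :=
    summable_of_ne_finset_zero (s := indices L) fun k hk => by simp [huout k hk]
  have hsum : ∑' k, ‖u k‖ ^ 2 = ∑ l ∈ indices L, ‖u l‖ ^ 2 :=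
    tsum_eq_sum fun k hk => by simp [huout k hk]
  have hdec : ∀ k : ℤ, freq T * |(k : ℝ) + x / freq T| * ‖u k‖ ^ 2 ≤
      α * (‖u k‖ * ∑ m ∈ Finset.Icc (-(M : ℤ)) M, ‖u (k - m)‖) := by
    intro k
    by_cases hk : k ∈ indices L
    · refine decay_hypothesis hT hα ?_
      rw [← heig k hk]
      refine Finset.sum_congr rfl fun m _ => ?_
      split_ifs with hkm
      · rfl
      · rw [huout _ hkm, map_zero]
    · simp [huout k hk]
  set S : ℝ := ∑ l ∈ indices L, ‖u l‖ ^ 2 with hS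
  have hSpos : 0 < S := by
    rw [hS, ← norm_truncate_sq, huψ]
    have := norm_pos_iff.2 hψ.2
    positivity
  -- a component coupled to the outside of `[L]` has `|l| ≥ L - M`
  set R : ℝ := L - M - |x| / freq T with hR
  set Y : ℝ := Real.exp (Real.sinh 1 * (α / freq T) - R / n) with hY
  have hYX : Y ≤ 2 * X := by
    have hYeq : Y = Real.exp (M / n) * X := by
      rw [hY, hX, sinh_mul_div_freq, ← Real.exp_add, hR]
      congr 1
      ring
    rw [hYeq]
    exact mul_le_mul_of_nonneg_right (exp_half_div_le M (by linarith)) hXpos.le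
  have hedge : ∀ l ∈ indices L, ∀ m ∈ Finset.Icc (-(M : ℤ)) M, l + m ∉ indices L →
      ‖u l‖ ≤ Y * √S := by
    intro l hl m hm hlm
    have hfar : R ≤ |(l : ℝ) + x / freq T| := by
      have h1 : (L : ℝ) - M ≤ |(l : ℝ)| := by
        have : (L : ℤ) - M ≤ |l| := by
          simp only [indices, Finset.mem_Icc] at hl hm hlm
          have := le_abs_self l
          have := neg_le_abs l
          omega
        exact_mod_cast this
      have h2 := abs_sub ((l : ℝ) + x / freq T) (x / freq T)
      rw [add_sub_cancel_right, abs_div, abs_of_pos hω] at h2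
      linarith
    have := le_exp_of_le_abs hω hα0 (fun k => norm_nonneg (u k)) hs hdec hfar
    rwa [hsum] at this
  obtain ⟨t₀, ht₀⟩ := exists_le_norm_trigPoly (L := L) hT u
  have hvS : √S ≤ ‖trigPoly T L u t₀‖ := Real.sqrt_le_iff.2 ⟨norm_nonneg _, ht₀⟩
  have hSs := Real.sqrt_pos.2 hSpos
  have hYpos : 0 < Y := Real.exp_pos _
  obtain ⟨ε, hε, hq, hle⟩ := exists_quasienergy_near_of_residual hT hH
    (fun t => hasDerivAt_trigPoly u t) (trigPoly_add_period (L := L) hT u)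
    (norm_residual_le hα (by positivity) heig hedge)
    (η := n * (M * (α * Y)) * T) (t₀ := t₀) (norm_pos_iff.1 (hSs.trans_le hvS)) (by
      calc n * (M * (α * (Y * √S))) * T = n * (M * (α * Y)) * T * √S := by ring
        _ ≤ _ := mul_le_mul_of_nonneg_left hvS (by positivity))
  refine ⟨ε, hε, hq, ?_⟩
  have hMn : (M : ℝ) ≤ n := by rw [hn]; linarith
  have h1 : n * (M * (α * Y)) * T ≤ n * (n * (α * (2 * X))) * T := by gcongr
  have h2 : 0 ≤ n ^ 2 * (α * T) * X := by positivity
  linarith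

end converse

/-! ### The cutoff -/

section cutoff

theorem mul_exp_neg_le {s y : ℝ} (hs : 0 < s) : y * Real.exp (-(s * y)) ≤ 1 / s := by
  have h := Real.add_one_le_exp (s * y)
  rw [Real.exp_neg, ← div_eq_mul_inv, div_le_div_iff₀ (Real.exp_pos _) hs]
  linarith

/-- With `n = 2M + 1`, a cutoff `L ≥ n (30 n² + 1) (y + log (1 / δ))` makes the error bounds, with
one spare unit in the exponent, at most `δ`. -/
theorem error_le_of_cutoff {n y δ ℓ c K s : ℝ} (hn : 1 ≤ n) (hy : 0 ≤ y) (hδ : 0 < δ) (hδ1 : δ ≤ 1)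
    (hℓ : n * (30 * n ^ 2 + 1) * (y + Real.log (1 / δ)) ≤ ℓ) (hc : c ≤ 1) (hK : K ≤ 9)
    (hs : s ≤ 1) :
    K * n ^ 2 * y * Real.exp (-((ℓ - s) / n) + c * y) ≤ δ := by
  have hn0 : 0 < n := by linarith
  have hlog : 0 ≤ Real.log (1 / δ) := Real.log_nonneg (by rw [le_div_iff₀ hδ]; linarith)
  have hlog' : Real.log (1 / δ) = -Real.log δ := by rw [one_div, Real.log_inv]
  have h1 : (30 * n ^ 2 + 1) * y + Real.log (1 / δ) ≤ ℓ / n := by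
    rw [le_div_iff₀ hn0]
    have : 0 ≤ n * (30 * n ^ 2) * Real.log (1 / δ) := by positivity
    nlinarith
  have h2 : s / n ≤ 1 := by
    rw [div_le_one hn0]; linarith
  have h3 : -((ℓ - s) / n) + c * y ≤ 1 + -(30 * n ^ 2 * y) + Real.log δ := by
    rw [sub_div]
    nlinarith
  have h4 : Real.exp (-((ℓ - s) / n) + c * y) ≤
      Real.exp 1 * Real.exp (-(30 * n ^ 2 * y)) * δ := by
    refine (Real.exp_le_exp.2 h3).trans (le_of_eq ?_)
    rw [Real.exp_add, Real.exp_add, Real.exp_log hδ]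
  have h5 := mul_exp_neg_le (s := 30 * n ^ 2) (y := y) (by positivity)
  have h6 : Real.exp 1 ≤ 3 := by linarith [Real.exp_one_lt_d9]
  calc K * n ^ 2 * y * Real.exp (-((ℓ - s) / n) + c * y)
      ≤ 9 * n ^ 2 * y * (3 * Real.exp (-(30 * n ^ 2 * y)) * δ) := by
        gcongr
        refine h4.trans ?_
        gcongr
    _ = 27 * n ^ 2 * δ * (y * Real.exp (-(30 * n ^ 2 * y))) := by ring
    _ ≤ 27 * n ^ 2 * δ * (1 / (30 * n ^ 2)) := by gcongr
    _ = 9 / 10 * δ := by field_simp; norm_num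
    _ ≤ δ := by linarith

theorem sinh_one_div_two_pi_le : Real.sinh 1 / (2 * Real.pi) ≤ 1 := by
  have hpi := Real.pi_gt_three
  rw [div_le_one (by positivity), Real.sinh_eq]
  have := Real.exp_one_lt_d9
  have := Real.exp_pos (-1)
  linarith

end cutoff

end Floquet

theorem theorem1 (M : ℕ) :
    ∃ C : ℝ, 0 < C ∧
    ∀ (E : Type*) [NormedAddCommGroup E] [InnerProductSpace ℂ E] [FiniteDimensional ℂ E]
      (T α : ℝ) (H : ℤ → E →L[ℂ] E),
      0 < T →
      (∀ t : ℝ, (Floquet.hamiltonian M T H t : E →ₗ[ℂ] E).IsSymmetric) →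
      (∀ m : ℤ, |m| ≤ (M : ℤ) → ‖H m‖ ≤ α) →
      -- explicit bound: every quasienergy, and its shifts, are approximated by eigenvalues
      (∀ L : ℕ, 1 ≤ L → ∀ ε ∈ Floquet.brillouinZone T, Floquet.IsQuasienergy M T H ε →
        ∀ l ∈ Floquet.indices L,
        ∃ x : ℝ, Floquet.IsTruncEigenvalue M T H L x ∧
          |x - (ε - (l : ℝ) * Floquet.freq T)| / Floquet.freq T ≤
            8 * (2 * (M : ℝ) + 1) ^ 2 * (α * T) *
              Real.exp (-(((L : ℝ) - |(l : ℝ)|) / (2 * (M : ℝ) + 1))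
                + Real.sinh 1 / (2 * Real.pi) * (α * T))) ∧
      -- explicit bound: every eigenvalue is approximated by a quasienergy
      (∀ (L : ℕ) (x : ℝ), Floquet.IsTruncEigenvalue M T H L x →
        ∃ ε ∈ Floquet.brillouinZone T, Floquet.IsQuasienergy M T H ε ∧
          |Floquet.modOne ((ε - x) / Floquet.freq T)| ≤
            9 * (2 * (M : ℝ) + 1) ^ 2 * (α * T) *
              Real.exp (-(((L : ℝ) - |x| / Floquet.freq T) / (2 * (M : ℝ) + 1))
                + Real.sinh 1 / (2 * Real.pi) * (α * T))) ∧
      -- a cutoff of order `α T + log (1 / δ)` gives accuracy `δ` in both directions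
      (∀ (δ : ℝ) (L : ℕ), 0 < δ → δ ≤ 1 → 1 ≤ L →
        C * (α * T + Real.log (1 / δ)) ≤ (L : ℝ) →
        (∀ ε ∈ Floquet.brillouinZone T, Floquet.IsQuasienergy M T H ε →
          ∃ x : ℝ, Floquet.IsTruncEigenvalue M T H L x ∧ |x - ε| / Floquet.freq T ≤ δ) ∧
        (∀ x ∈ Set.Ico (-Floquet.freq T) (Floquet.freq T), Floquet.IsTruncEigenvalue M T H L x →
          ∃ ε ∈ Floquet.brillouinZone T, Floquet.IsQuasienergy M T H ε ∧
            |Floquet.modOne ((ε - x) / Floquet.freq T)| ≤ δ)) := by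
  have hn : (1 : ℝ) ≤ 2 * M + 1 := by linarith [(Nat.cast_nonneg M : (0 : ℝ) ≤ M)]
  refine ⟨(2 * M + 1) * (30 * (2 * M + 1) ^ 2 + 1), by positivity, ?_⟩
  intro E _ _ _ T α H hT hH hα
  have hω := Floquet.freq_pos hT
  have hy : 0 ≤ α * T := mul_nonneg (Floquet.nonneg_of_norm_le hα) hT.le
  refine ⟨fun L _ ε hε hq l hl => Floquet.exists_truncEigenvalue_near_quasienergy hT hH hα hε hq hl,
    fun L x hx => Floquet.exists_quasienergy_near_truncEigenvalue hT hH hα hx,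
    fun δ L hδ hδ1 hL hcut => ⟨fun ε hε hq => ?_, fun x hxmem hx => ?_⟩⟩
  · have h0 : (0 : ℤ) ∈ Floquet.indices L := by
      rw [Floquet.indices, Finset.mem_Icc]; omega
    obtain ⟨x, hx, hle⟩ := Floquet.exists_truncEigenvalue_near_quasienergy hT hH hα hε hq h0
    refine ⟨x, hx, ?_⟩
    rw [Int.cast_zero, zero_mul, sub_zero, abs_zero] at hle
    exact hle.trans (Floquet.error_le_of_cutoff hn hy hδ hδ1 hcut Floquet.sinh_one_div_two_pi_le
      (by norm_num) zero_le_one)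
  · obtain ⟨ε, hε, hq, hle⟩ := Floquet.exists_quasienergy_near_truncEigenvalue hT hH hα hx
    refine ⟨ε, hε, hq, hle.trans (Floquet.error_le_of_cutoff hn hy hδ hδ1 hcut
      Floquet.sinh_one_div_two_pi_le le_rfl ?_)⟩
    rw [div_le_one hω]
    exact abs_le.2 ⟨hxmem.1, hxmem.2.le⟩
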